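/- For real $a,b,c>0$ let $F(a,b;c;z)=\sum_{n\ge 0}\frac{(a,n)(b,n)}{(c,n)}\frac{z^n}{n!}$, $|z|<1$, be the Gaussian hypergeometric series, where $(a,n)=a(a+1)\cdots(a+n-1)$ and $(a,0)=1$. Let $B(x,y)=\Gamma(x)\Gamma(y)/\Gamma(x+y)$ be the beta function, $\Psi=\Gamma'/\Gamma$ the digamma function, $\gamma$ the Euler--Mascheroni constant and $R(a,b)=-\Psi(a)-\Psi(b)-2\gamma$. For $r\in(0,1)$ write $r'=\sqrt{1-r^2}$, let $\operatorname{arth}$ be the inverse hyperbolic tangent, and for $0<a<c$ let $$\mu_{a,c}(r)=\frac{B(a,c-a)}{2}\,\frac{F(a,c-a;c;r'^2)}{F(a,c-a;c;r^2)},\qquad 0<r<1 .$$ **Theorem.** Let $0<a<c\le 1$ and $B=B(a,c-a)$. In (1)–(3), a value at $r=1$ means the limit as $r\to1^-$, which exists and equals $0$, $B^2/2$ and $(B/2)^2$, respectively. 1. $f_1(r)=\mu_{a,c}(r)+\log r$ is strictly decreasing from $(0,1]$ onto $[0,R(a,c-a)/2)$. 2. $f_2(r)=\dfrac{r'^2\log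 r'}{r^2\log r}\,\mu_{a,c}(r)$ is strictly increasing from $(0,1]$ onto $(1/2,B^2/2]$. 3. $f_3(r)=\dfrac{r'\operatorname{arth}(r)}{r\operatorname{arth}(r')}\,\mu_{a,c}(r)$ is strictly increasing from $(0,1)$ onto $(1,(B/2)^2)$, and, extended to $r=1$, from $(0,1]$ onto $(1,(B/2)^2]$. 4. $f_4(r)=r'\mu_{a,c}(r)/\log(1/r)$ and $\tilde f_4(r)=\mu_{a,c}(r)/\log(1/r)$ are both strictly increasing from $(0,1)$ onto $(1,\infty)$. 5. $f_5(r)=\mu_{a,c}(r)\operatorname{arth}(r)$ is strictly increasing from $(0,1)$ onto $(0,(B/2)^2)$. 6. $f_6(r)=\mu_{a,c}(r)\log(r/r')$ is strictly increasing from $[1/\sqrt2,1)$ onto $[0,(B/2)^2)$. -/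

import Mathlib

open Set Filter Topology

noncomputable section

namespace GenModulus

/-- The complementary argument `r' = √(1 - r²)`. -/
def compl (r : ℝ) : ℝ := Real.sqrt (1 - r ^ 2)

/-- The Euler beta function `B(x, y) = Γ(x) Γ(y) / Γ(x + y)`. -/
def B (x y : ℝ) : ℝ := Real.Gamma x * Real.Gamma y / Real.Gamma (x + y)

/-- The digamma function `Ψ = Γ' / Γ` on the real line. -/
def Psi (x : ℝ) : ℝ := deriv Real.Gamma x / Real.Gamma x

/-- The Ramanujan constant `R(a, b) = -Ψ(a) - Ψ(b) - 2γ`. -/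
def R (a b : ℝ) : ℝ := -Psi a - Psi b - 2 * Real.eulerMascheroniConstant

/-- The generalized modulus `μ_{a,b,c}(r)`, meant for `0 < r < 1`; `₂F₁` is the Gaussian
hypergeometric series. -/
def mu₃ (a b c r : ℝ) : ℝ :=
  B a b / 2 * (₂F₁ a b c (compl r ^ 2) / ₂F₁ a b c (r ^ 2))

/-- The generalized modulus `μ_{a,c} = μ_{a,c-a,c}`. -/
def mu (a c r : ℝ) : ℝ := mu₃ a (c - a) c r

/-- `f₁(r) = μ_{a,c}(r) + log r`. -/
def f₁ (a c r : ℝ) : ℝ := mu a c r + Real.log r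

/-- `f₂(r) = (r'² log r' / (r² log r)) μ_{a,c}(r)`. -/
def f₂ (a c r : ℝ) : ℝ :=
  compl r ^ 2 * Real.log (compl r) / (r ^ 2 * Real.log r) * mu a c r

/-- `f₃(r) = (r' arth r / (r arth r')) μ_{a,c}(r)`. -/
def f₃ (a c r : ℝ) : ℝ :=
  compl r * Real.artanh r / (r * Real.artanh (compl r)) * mu a c r

/-- `f₄(r) = r' μ_{a,c}(r) / log (1/r)`. -/
def f₄ (a c r : ℝ) : ℝ := compl r * mu a c r / Real.log (1 / r)

/-- `f̃₄(r) = μ_{a,c}(r) / log (1/r)`. -/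
def f₄' (a c r : ℝ) : ℝ := mu a c r / Real.log (1 / r)

/-- `f₅(r) = μ_{a,c}(r) arth r`. -/
def f₅ (a c r : ℝ) : ℝ := mu a c r * Real.artanh r

/-- `f₆(r) = μ_{a,c}(r) log (r/r')`. -/
def f₆ (a c r : ℝ) : ℝ := mu a c r * Real.log (r / compl r)

end GenModulus

end

open Set Filter Topology

noncomputable section

namespace GenModulus

/-! ### Power series with slowly growing coefficients -/

/-! With b = c - a, x = r² and F = F(a,b;a+b;·), the modulus is (B/2) F(1-x)/F(x), and c ≤ 1 becomes
a + b ≤ 1.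

The functions `f₂` to `f₅` have the form C φ(1-x)/ψ(x) with φ and ψ taken from F/(-log(1-x)/x),
F/(artanh √x/√x), √(1-x) F and (1-x) F. Each of these is positive, strictly decreasing and tends to
1 at 0, so the quotient increases, and its range is read off from the limits of φ and ψ at 1. The
first two decrease by the Biernacki–Krzyż rule `ser_mul_ser_lt`, the other two because (1-x)F² has
negative derivative.

The limits at 1 follow from n c_n → 1/B for the coefficients c_n of F, and from Ramanujan's
asymptotic B F(x) + log(1-x)/x → R(a,b). By Abel's theorem the latter reduces to the numerical
series `tsum_ramanujanTerm`. Its sum and R(a,b) are both decreasing in a and solve φ(a) - φ(a+1) =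
1/a, so they differ by a constant, which symmetry and the case a = b = 1 show to be 0.

For `f₁` and `f₆` one differentiates F(1-x)/F(x), which gives -Λ/(x(1-x)F²) with Λ = `legendre`.
Since Λ is symmetric about 1/2 and monotone on (0,1/2], it is at least its limit 1/B at 0; with
(1-x)F² < 1 this settles `f₁`. For `f₆` one needs Λ log(x/(1-x)) < F(x)F(1-x) for x > 1/2, which is
extracted from the monotonicity of F/(-log(1-x)/x) in `mul_log_le`. -/

/-- The sum of the real power series with coefficients `p`. -/
def ser (p : ℕ → ℝ) (x : ℝ) : ℝ := ∑' n, p n * x ^ n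

lemma summable_succ_mul_geometric {x : ℝ} (hx : |x| < 1) :
    Summable fun n : ℕ => ((n : ℝ) + 1) * x ^ n := by
  have h1 := summable_pow_mul_geometric_of_norm_lt_one 1 (r := x) (by simpa using hx)
  have h0 := summable_pow_mul_geometric_of_norm_lt_one 0 (r := x) (by simpa using hx)
  refine (h1.add h0).congr fun n => ?_
  ring

lemma summable_ser {p : ℕ → ℝ} (hp : ∀ n, |p n| ≤ n + 1) {x : ℝ} (hx : |x| < 1) :
    Summable fun n => p n * x ^ n := by
  refine Summable.of_norm_bounded (summable_succ_mul_geometric (x := |x|) (by simpa using hx))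
    fun n => ?_
  rw [norm_mul, norm_pow, Real.norm_eq_abs, Real.norm_eq_abs]
  gcongr
  exact hp n

lemma abs_le_succ_of_abs_le_one {p : ℕ → ℝ} (hp : ∀ n, |p n| ≤ 1) (n : ℕ) :
    |p n| ≤ (n : ℝ) + 1 := by
  have := n.cast_nonneg (α := ℝ)
  linarith [hp n]

/-- The coefficients of the differentiated power series. -/
def dcoef (p : ℕ → ℝ) (n : ℕ) : ℝ := (n + 1) * p (n + 1)

lemma abs_dcoef_le {p : ℕ → ℝ} (hp : ∀ n, |p n| ≤ 1) (n : ℕ) : |dcoef p n| ≤ (n : ℝ) + 1 := by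
  have h : (0 : ℝ) ≤ n + 1 := by positivity
  rw [dcoef, abs_mul, abs_of_nonneg h]
  exact mul_le_of_le_one_right h (hp _)

lemma mul_ser_dcoef {p : ℕ → ℝ} (hp : ∀ n, |p n| ≤ 1) {x : ℝ} (hx : |x| < 1) :
    x * ser (dcoef p) x = ser (fun n : ℕ => n * p n) x := by
  have hs : Summable fun n : ℕ => ((n : ℝ) * p n) * x ^ n := by
    refine summable_ser (p := fun n : ℕ => (n : ℝ) * p n) (fun n => ?_) hx
    rw [abs_mul, Nat.abs_cast]
    have := mul_le_of_le_one_right n.cast_nonneg (hp n) (a := (n : ℝ))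
    linarith
  rw [ser, ser, hs.tsum_eq_zero_add, ← tsum_mul_left]
  simp only [Nat.cast_zero, zero_mul, zero_add]
  refine tsum_congr fun n => ?_
  simp only [dcoef]
  push_cast
  ring

lemma hasDerivAt_ser {p : ℕ → ℝ} (hp : ∀ n, |p n| ≤ 1) {x : ℝ} (hx : |x| < 1) :
    HasDerivAt (ser p) (ser (dcoef p) x) x := by
  -- On the ball of radius r the differentiated terms are dominated by n r^(n-1), which is summable
  -- because r < 1.
  obtain ⟨r, hxr, hr1⟩ := exists_between hx
  have hr0 : 0 < r := (abs_nonneg x).trans_lt hxr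
  have hu : Summable fun n : ℕ => (n : ℝ) * r ^ (n - 1) := by
    rw [← summable_nat_add_iff 1]
    simpa using summable_succ_mul_geometric (x := r) (by rwa [abs_of_pos hr0])
  have hd := hasDerivAt_tsum_of_isPreconnected (y₀ := 0) (y := x) (t := Metric.ball (0 : ℝ) r)
    (g := fun n y => p n * y ^ n) (g' := fun n y => p n * (n * y ^ (n - 1))) hu Metric.isOpen_ball
    (convex_ball _ _).isPreconnected
    (fun n y _ => (hasDerivAt_pow n y).const_mul (p n)) (fun n y hy => ?_)
    (Metric.mem_ball_self hr0)
    (summable_ser (abs_le_succ_of_abs_le_one hp) (by simp)) (by simpa using hxr)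
  · have hs : Summable fun n : ℕ => p n * (n * x ^ (n - 1)) := by
      rw [← summable_nat_add_iff 1]
      refine (summable_ser (abs_dcoef_le hp) hx).congr fun n => ?_
      simp [dcoef]
      ring
    refine hd.congr_deriv ?_
    rw [hs.tsum_eq_zero_add, ser]
    simp only [Nat.cast_zero, zero_mul, mul_zero, zero_add]
    refine tsum_congr fun n => ?_
    simp [dcoef]
    ring
  · have hy' : |y| < r := by simpa using hy
    rw [norm_mul, norm_mul, norm_pow, Real.norm_eq_abs, Real.norm_eq_abs, Real.norm_eq_abs,
      Nat.abs_cast]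
    calc |p n| * (n * |y| ^ (n - 1)) ≤ 1 * (n * r ^ (n - 1)) := by gcongr; exact hp n
      _ = _ := one_mul _

lemma ser_zero (p : ℕ → ℝ) : ser p 0 = p 0 := by
  rw [ser, tsum_eq_single 0 fun n hn => by simp [hn]]
  simp

lemma ser_pos {p : ℕ → ℝ} (hp : ∀ n, |p n| ≤ 1) (h0 : ∀ n, 0 < p n) {x : ℝ} (hx0 : 0 ≤ x)
    (hx : x < 1) : 0 < ser p x :=
  (summable_ser (abs_le_succ_of_abs_le_one hp) (by rwa [abs_of_nonneg hx0])).tsum_pos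
    (fun n => mul_nonneg (h0 n).le (pow_nonneg hx0 n)) 0 (by simpa using h0 0)

lemma ser_le_ser {p q : ℕ → ℝ} (hp : ∀ n, |p n| ≤ 1) (hq : ∀ n, |q n| ≤ 1)
    (h : ∀ n, p n ≤ q n) {x : ℝ} (hx0 : 0 ≤ x) (hx : x < 1) : ser p x ≤ ser q x := by
  have hx' : |x| < 1 := by rwa [abs_of_nonneg hx0]
  exact (summable_ser (abs_le_succ_of_abs_le_one hp) hx').tsum_le_tsum
    (fun n => mul_le_mul_of_nonneg_right (h n) (pow_nonneg hx0 n))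
    (summable_ser (abs_le_succ_of_abs_le_one hq) hx')

/-- Biernacki–Krzyż: if the quotients `p n / q n` of positive coefficients are antitone and
not constant, the quotient of the sums is strictly antitone. -/
lemma ser_mul_ser_lt {p q : ℕ → ℝ} (hp1 : ∀ n, |p n| ≤ 1) (hq1 : ∀ n, |q n| ≤ 1)
    (hp : ∀ n, 0 < p n) (hq : ∀ n, 0 < q n) (h : ∀ n, p (n + 1) * q n ≤ p n * q (n + 1))
    (h01 : p 1 * q 0 < p 0 * q 1) {x y : ℝ} (hx0 : 0 ≤ x) (hxy : x < y) (hy : y < 1) :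
    ser p y * ser q x < ser p x * ser q y := by
  have hy0 : 0 ≤ y := hx0.trans hxy.le
  have hanti : Antitone fun n => p n / q n :=
    antitone_nat_of_succ_le fun n => by
      rw [div_le_div_iff₀ (hq _) (hq _)]
      exact h n
  have hmn : ∀ m n, m ≤ n → p n * q m ≤ p m * q n := fun m n hmn => by
    have := hanti hmn
    rwa [div_le_div_iff₀ (hq _) (hq _)] at this
  have key : ∀ m n, m ≤ n → x ^ n * y ^ m ≤ x ^ m * y ^ n := fun m n hmn => by
    obtain ⟨k, rfl⟩ := Nat.exists_eq_add_of_le hmn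
    have h1 : x ^ k ≤ y ^ k := pow_le_pow_left₀ hx0 hxy.le k
    have h2 : 0 ≤ x ^ m * y ^ m := by positivity
    rw [pow_add, pow_add]
    nlinarith
  have hS : ∀ {u : ℕ → ℝ}, (∀ n, |u n| ≤ 1) → ∀ {z : ℝ}, 0 ≤ z → z < 1 →
      Summable fun n => u n * z ^ n := fun hu z hz0 hz =>
    summable_ser (abs_le_succ_of_abs_le_one hu) (by rwa [abs_of_nonneg hz0])
  have hx : x < 1 := hxy.trans hy
  have hn : ∀ {u : ℕ → ℝ}, (∀ n, 0 < u n) → ∀ {z : ℝ}, 0 ≤ z → 0 ≤ fun n => u n * z ^ n :=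
    fun hu z hz0 n => mul_nonneg (hu n).le (pow_nonneg hz0 n)
  have s1 := (hS hp1 hx0 hx).mul_of_nonneg (hS hq1 hy0 hy) (hn hp hx0) (hn hq hy0)
  have s2 := (hS hp1 hy0 hy).mul_of_nonneg (hS hq1 hx0 hx) (hn hp hy0) (hn hq hx0)
  have e1 := (hS hp1 hx0 hx).tsum_mul_tsum (hS hq1 hy0 hy) s1
  have e2 := (hS hp1 hy0 hy).tsum_mul_tsum (hS hq1 hx0 hx) s2
  have e := s1.sub s2
  have e' : Summable fun z : ℕ × ℕ => p z.2 * x ^ z.2 * (q z.1 * y ^ z.1) -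
      p z.2 * y ^ z.2 * (q z.1 * x ^ z.1) := (Equiv.prodComm ℕ ℕ).summable_iff.mpr e
  have hsum := s1.tsum_sub s2
  have hsw : ∑' z : ℕ × ℕ, (p z.1 * x ^ z.1 * (q z.2 * y ^ z.2) -
      p z.1 * y ^ z.1 * (q z.2 * x ^ z.2)) = _ := ((Equiv.prodComm ℕ ℕ).tsum_eq _).symm
  have hpos : 0 < ∑' z : ℕ × ℕ, ((p z.1 * x ^ z.1 * (q z.2 * y ^ z.2) -
      p z.1 * y ^ z.1 * (q z.2 * x ^ z.2)) + (p z.2 * x ^ z.2 * (q z.1 * y ^ z.1) -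
      p z.2 * y ^ z.2 * (q z.1 * x ^ z.1))) := by
    refine (e.add e').tsum_pos (fun z => ?_) (0, 1) ?_
    · have : (p z.1 * x ^ z.1 * (q z.2 * y ^ z.2) -
          p z.1 * y ^ z.1 * (q z.2 * x ^ z.2)) + (p z.2 * x ^ z.2 * (q z.1 * y ^ z.1) -
          p z.2 * y ^ z.2 * (q z.1 * x ^ z.1)) =
          (p z.1 * q z.2 - p z.2 * q z.1) * (x ^ z.1 * y ^ z.2 - x ^ z.2 * y ^ z.1) := by ring
      rw [this]
      rcases le_total z.1 z.2 with hz | hz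
      · exact mul_nonneg (sub_nonneg.2 (hmn _ _ hz)) (sub_nonneg.2 (key _ _ hz))
      · exact mul_nonneg_of_nonpos_of_nonpos (sub_nonpos.2 (hmn _ _ hz))
          (sub_nonpos.2 (key _ _ hz))
    · simp only [pow_zero, pow_one]
      nlinarith
  rw [e.tsum_add e'] at hpos
  simp only [Equiv.prodComm_apply, Prod.fst_swap, Prod.snd_swap] at hsw
  rw [← hsw, hsum] at hpos
  simp only [ser]
  rw [e1, e2]
  linarith

/-! ### The coefficients of the zero-balanced hypergeometric series -/

/-- The coefficients of `F(a, b; a + b; ·)`. -/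
def coef (a b : ℝ) (n : ℕ) : ℝ := ordinaryHypergeometricCoefficient a b (a + b) n

lemma coef_zero (a b : ℝ) : coef a b 0 = 1 := by
  simp [coef, ordinaryHypergeometricCoefficient]

lemma coef_succ (a b : ℝ) (n : ℕ) :
    coef a b (n + 1) = coef a b n * ((a + n) * (b + n) / ((a + b + n) * (n + 1))) := by
  simp only [coef, ordinaryHypergeometricCoefficient, ascPochhammer_succ_eval, Nat.factorial_succ]
  push_cast
  rw [mul_inv, mul_inv, div_eq_mul_inv, mul_inv]
  ring

lemma coef_comm (a b : ℝ) : coef a b = coef b a := by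
  funext n
  simp only [coef, ordinaryHypergeometricCoefficient, add_comm a b]
  ring

lemma hyp_eq_ser (a b : ℝ) : (₂F₁ a b (a + b) : ℝ → ℝ) = ser (coef a b) := by
  rw [ordinaryHypergeometric_eq_tsum]
  rfl

section
variable {a b : ℝ}

lemma coef_pos (ha : 0 < a) (hb : 0 < b) (n : ℕ) : 0 < coef a b n := by
  induction n with
  | zero => simp [coef_zero]
  | succ n ih =>
    rw [coef_succ]
    positivity

lemma coef_le_one (ha : 0 < a) (hb : 0 < b) (hab : a + b ≤ 1) (n : ℕ) : coef a b n ≤ 1 := by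
  induction n with
  | zero => simp [coef_zero]
  | succ n ih =>
    rw [coef_succ]
    refine mul_le_one₀ ih (by positivity) ?_
    rw [div_le_one (by positivity)]
    have := n.cast_nonneg (α := ℝ)
    nlinarith

lemma abs_coef_le_one (ha : 0 < a) (hb : 0 < b) (hab : a + b ≤ 1) (n : ℕ) : |coef a b n| ≤ 1 := by
  rw [abs_of_pos (coef_pos ha hb n)]
  exact coef_le_one ha hb hab n

/-- This identity drives the whole file: it gives the monotonicity of n c_n, the formula for
(1-x)F', and the telescoping sums. -/
lemma succ_mul_coef_succ_sub (ha : 0 < a) (hb : 0 < b) (n : ℕ) :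
    ((n : ℝ) + 1) * coef a b (n + 1) - n * coef a b n = a * b / (a + b + n) * coef a b n := by
  rw [coef_succ]
  field_simp
  ring

lemma ascPochhammer_eval_eq_prod (x : ℝ) (n : ℕ) :
    (ascPochhammer ℝ n).eval x = ∏ j ∈ Finset.range n, (x + j) := by
  induction n with
  | zero => simp
  | succ n ih => rw [ascPochhammer_succ_eval, ih, Finset.prod_range_succ]

lemma B_pos (ha : 0 < a) (hb : 0 < b) : 0 < B a b :=
  div_pos (mul_pos (Real.Gamma_pos_of_pos ha) (Real.Gamma_pos_of_pos hb))
    (Real.Gamma_pos_of_pos (add_pos ha hb))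

lemma B_comm (a b : ℝ) : B a b = B b a := by
  rw [B, B, add_comm a b, mul_comm (Real.Gamma a)]

/-- After a shift by one the term equals a quotient of Euler's products for Γ at a + b, a and b, in
which the powers of n cancel. -/
lemma tendsto_nat_mul_coef (ha : 0 < a) (hb : 0 < b) :
    Tendsto (fun n : ℕ => (n : ℝ) * coef a b n) atTop (𝓝 (B a b)⁻¹) := by
  rw [← tendsto_add_atTop_iff_nat 1]
  have hlim := (Real.GammaSeq_tendsto_Gamma (a + b)).div
    ((Real.GammaSeq_tendsto_Gamma a).mul (Real.GammaSeq_tendsto_Gamma b))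
    (mul_pos (Real.Gamma_pos_of_pos ha) (Real.Gamma_pos_of_pos hb)).ne'
  rw [B, inv_div]
  refine hlim.congr' ?_
  filter_upwards [eventually_gt_atTop 0] with n hn
  have hn' : (0 : ℝ) < n := by exact_mod_cast hn
  have hP : ∀ {x : ℝ}, 0 < x → 0 < ∏ j ∈ Finset.range (n + 1), (x + j) := fun hx =>
    Finset.prod_pos fun j _ => by positivity
  have h1 := hP ha
  have h2 := hP hb
  have h3 := hP (add_pos ha hb)
  have hf : (0 : ℝ) < n.factorial := by exact_mod_cast n.factorial_pos
  simp only [Pi.div_apply, Real.GammaSeq, coef, ordinaryHypergeometricCoefficient,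
    ascPochhammer_eval_eq_prod, Real.rpow_add hn', Nat.factorial_succ]
  have ea : (0 : ℝ) < (n : ℝ) ^ a := Real.rpow_pos_of_pos hn' a
  have eb : (0 : ℝ) < (n : ℝ) ^ b := Real.rpow_pos_of_pos hn' b
  push_cast
  field_simp

lemma nat_mul_coef_monotone (ha : 0 < a) (hb : 0 < b) :
    Monotone fun n : ℕ => (n : ℝ) * coef a b n := by
  refine monotone_nat_of_le_succ fun n => ?_
  have h := succ_mul_coef_succ_sub ha hb n
  have : 0 ≤ a * b / (a + b + n) * coef a b n := by have := coef_pos ha hb n; positivity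
  push_cast
  linarith

lemma nat_mul_coef_le (ha : 0 < a) (hb : 0 < b) (n : ℕ) : (n : ℝ) * coef a b n ≤ (B a b)⁻¹ :=
  (nat_mul_coef_monotone ha hb).ge_of_tendsto (tendsto_nat_mul_coef ha hb) n

lemma exists_sub_nat_mul_coef_le (ha : 0 < a) (hb : 0 < b) :
    ∃ M : ℝ, ∀ n : ℕ, (B a b)⁻¹ - ((n : ℝ) + 1) * coef a b (n + 1) ≤ M / (n + 1) := by
  set K := (B a b)⁻¹
  have hK : 0 < K := inv_pos.2 (B_pos ha hb)
  refine ⟨a * b * K * (1 + 1 / (a + b)), fun n => ?_⟩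
  -- M is chosen so that M/(m+1) - M/(m+2) dominates the increment of n c_n. This amounts to m + 2 ≤
  -- (1 + 1/(a+b))(a+b+m+1). The corrected sequence then decreases to K.
  set M := a * b * K * (1 + 1 / (a + b)) with hM
  have hanti : Antitone fun n : ℕ => ((n : ℝ) + 1) * coef a b (n + 1) + M / (n + 1) := by
    refine antitone_nat_of_succ_le fun m => ?_
    have h := succ_mul_coef_succ_sub ha hb (m + 1)
    have hv := nat_mul_coef_le ha hb (m + 1)
    push_cast at h hv ⊢
    have hc : coef a b (m + 1) ≤ K / (m + 1) := by
      rw [le_div_iff₀ (by positivity)]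
      linarith
    have h1 : a * b / (a + b + (m + 1)) * coef a b (m + 1)
        ≤ a * b / (a + b + (m + 1)) * (K / (m + 1)) := by gcongr
    have h2 : a * b / (a + b + (m + 1)) * (K / (m + 1)) ≤ M / (m + 1) - M / (m + 1 + 1) := by
      have e : M / (m + 1) - M / (m + 1 + 1)
          - a * b / (a + b + (m + 1)) * (K / (m + 1)) =
          a * b * K / ((m + 1) * (m + 2) * (a + b + (m + 1))) * ((m + 1) / (a + b) + (a + b)) := by
        rw [hM]
        field_simp
        ring
      have : 0 ≤ a * b * K / ((m + 1) * (m + 2) * (a + b + (m + 1))) *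
        (((m : ℝ) + 1) / (a + b) + (a + b)) := by positivity
      linarith
    linarith
  have hlim : Tendsto (fun n : ℕ => ((n : ℝ) + 1) * coef a b (n + 1) + M / (n + 1)) atTop
      (𝓝 (K + 0)) := by
    refine Tendsto.add ?_ (tendsto_const_div_atTop_nhds_zero_nat M |>.comp (tendsto_add_atTop_nat 1)
      |>.congr fun n => by simp)
    refine ((tendsto_add_atTop_iff_nat 1).2 (tendsto_nat_mul_coef ha hb)).congr fun n => ?_
    push_cast
    rfl
  have := hanti.le_of_tendsto hlim n
  simp only [add_zero] at this
  linarith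

end

/-! ### The digamma function and the Ramanujan constant -/

lemma differentiableAt_Gamma_of_pos {x : ℝ} (hx : 0 < x) : DifferentiableAt ℝ Real.Gamma x :=
  Real.differentiableAt_Gamma fun m => by
    have := m.cast_nonneg (α := ℝ)
    linarith

lemma deriv_log_Gamma {x : ℝ} (hx : 0 < x) : deriv (Real.log ∘ Real.Gamma) x = Psi x :=
  Real.deriv_log_comp_eq_logDeriv (differentiableAt_Gamma_of_pos hx) (Real.Gamma_pos_of_pos hx).ne'

lemma Psi_monotoneOn : MonotoneOn Psi (Ioi 0) := by
  have h := Real.convexOn_log_Gamma.monotoneOn_deriv fun x (hx : 0 < x) =>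
    (differentiableAt_Gamma_of_pos hx).log (Real.Gamma_pos_of_pos hx).ne'
  exact h.congr fun x hx => deriv_log_Gamma hx

lemma Psi_one : Psi 1 = -Real.eulerMascheroniConstant := by
  rw [Psi, Real.hasDerivAt_Gamma_one.deriv, Real.Gamma_one, div_one]

lemma Psi_add_one {x : ℝ} (hx : 0 < x) : Psi (x + 1) = Psi x + 1 / x := by
  have hd := (differentiableAt_Gamma_of_pos hx).hasDerivAt
  have h1 : HasDerivAt (fun y => y * Real.Gamma y) (1 * Real.Gamma x + x * deriv Real.Gamma x) x :=
    (hasDerivAt_id x).mul hd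
  have h2 : HasDerivAt (fun y => Real.Gamma (y + 1)) (deriv Real.Gamma (x + 1)) x := by
    have := (differentiableAt_Gamma_of_pos (x := x + 1) (by linarith)).hasDerivAt
    exact this.comp_add_const x 1
  have h3 := h2.congr_of_eventuallyEq (f₁ := fun y => y * Real.Gamma y) <| by
    filter_upwards [lt_mem_nhds hx] with y hy
    exact (Real.Gamma_add_one hy.ne').symm
  have hG := (Real.Gamma_pos_of_pos hx).ne'
  rw [Psi, Psi, h3.unique h1, Real.Gamma_add_one hx.ne']
  field_simp
  ring

/-- Log-convexity: y and x + b lie between x and y + b and are convex combinations of them with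
interchanged weights, so the two convexity inequalities add up. -/
lemma Gamma_mul_Gamma_le {x y b : ℝ} (hx : 0 < x) (hxy : x ≤ y) (hb : 0 < b) :
    Real.Gamma y * Real.Gamma (x + b) ≤ Real.Gamma x * Real.Gamma (y + b) := by
  have hy : 0 < y := hx.trans_le hxy
  have gx := Real.Gamma_pos_of_pos hx
  have gy := Real.Gamma_pos_of_pos hy
  have gxb := Real.Gamma_pos_of_pos (add_pos hx hb)
  have gyb := Real.Gamma_pos_of_pos (add_pos hy hb)
  have hd : 0 < y + b - x := by linarith
  set s := (y - x) / (y + b - x) with hs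
  have hs0 : 0 ≤ s := div_nonneg (by linarith) hd.le
  have hs1 : 0 ≤ 1 - s := by
    rw [sub_nonneg, hs, div_le_one hd]
    linarith
  have e1 : (1 - s) • x + s • (y + b) = y := by
    simp only [smul_eq_mul, hs]
    field_simp
    ring
  have e2 : s • x + (1 - s) • (y + b) = x + b := by
    simp only [smul_eq_mul, hs]
    field_simp
    ring
  have hconv := Real.convexOn_log_Gamma
  have c1 := hconv.2 (show x ∈ Ioi 0 from hx) (show y + b ∈ Ioi 0 from add_pos hy hb) hs1 hs0
    (by ring)
  have c2 := hconv.2 (show x ∈ Ioi 0 from hx) (show y + b ∈ Ioi 0 from add_pos hy hb) hs0 hs1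
    (by ring)
  rw [e1] at c1
  rw [e2] at c2
  simp only [Function.comp_apply, smul_eq_mul] at c1 c2
  rw [← Real.log_le_log_iff (mul_pos gy gxb) (mul_pos gx gyb), Real.log_mul gy.ne' gxb.ne',
    Real.log_mul gx.ne' gyb.ne']
  linarith

/-- Two antitone functions satisfying `φ x - φ (x + 1) = 1 / x` differ by a constant. -/
lemma sub_eq_of_antitoneOn_of_sub_add_one {φ ψ : ℝ → ℝ} (hφ : AntitoneOn φ (Ioi 0))
    (hψ : AntitoneOn ψ (Ioi 0)) (hφ1 : ∀ x, 0 < x → φ x - φ (x + 1) = 1 / x)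
    (hψ1 : ∀ x, 0 < x → ψ x - ψ (x + 1) = 1 / x) {x : ℝ} (hx : 0 < x) :
    φ x - ψ x = φ 1 - ψ 1 := by
  have hper : ∀ y, 0 < y → ∀ k : ℕ, φ (y + k) - ψ (y + k) = φ y - ψ y := fun y hy k => by
    induction k with
    | zero => simp
    | succ k ih =>
      have h1 := hφ1 (y + k) (by positivity)
      have h2 := hψ1 (y + k) (by positivity)
      push_cast
      rw [← add_assoc]
      linarith
  -- By `hper` the difference φ - ψ has period 1. After a shift by k + 1 the point x lies between m
  -- + k + 1 and m + k + 2, and on that interval each function varies by at most 1/(m+k+1), which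
  -- tends to 0.
  set m := ⌊x⌋₊
  have hm1 : (m : ℝ) ≤ x := Nat.floor_le hx.le
  have hm2 : x < m + 1 := Nat.lt_floor_add_one x
  have key : ∀ k : ℕ, |(φ x - ψ x) - (φ 1 - ψ 1)| ≤ 1 / ((k : ℝ) + 1) := fun k => by
    have hp1 : (0 : ℝ) < m + (k + 1) := by positivity
    have hp2 : (0 : ℝ) < x + (k + 1) := by positivity
    have hp3 : (0 : ℝ) < m + (k + 1) + 1 := by positivity
    have a1 := hφ (a := m + (k + 1)) (b := x + (k + 1)) hp1 hp2 (by linarith)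
    have a2 := hφ (a := x + (k + 1)) (b := m + (k + 1) + 1) hp2 hp3 (by linarith)
    have b1 := hψ (a := m + (k + 1)) (b := x + (k + 1)) hp1 hp2 (by linarith)
    have b2 := hψ (a := x + (k + 1)) (b := m + (k + 1) + 1) hp2 hp3 (by linarith)
    have p1 := hper x hx (k + 1)
    have p2 := hper 1 one_pos (m + k)
    have r1 := hφ1 (m + (k + 1)) hp1
    have r2 := hψ1 (m + (k + 1)) hp1
    have e : (1 : ℝ) + (m + k) = m + (k + 1) := by ring
    push_cast at p1 p2
    rw [e] at p2
    have hle : 1 / ((m : ℝ) + (k + 1)) ≤ 1 / (k + 1) :=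
      one_div_le_one_div_of_le (by positivity) (by linarith [m.cast_nonneg (α := ℝ)])
    rw [abs_le]
    constructor <;> linarith
  have h0 : |(φ x - ψ x) - (φ 1 - ψ 1)| ≤ 0 :=
    ge_of_tendsto' tendsto_one_div_add_atTop_nhds_zero_nat key
  exact sub_eq_zero.1 (abs_nonpos_iff.1 h0)

/-- The coefficients of `B F(x) + log (1 - x) / x`. -/
def ramanujanTerm (a b : ℝ) (n : ℕ) : ℝ := B a b * coef a b n - 1 / ((n : ℝ) + 1)

section
variable {a b : ℝ}

lemma B_mul_coef (ha : 0 < a) (hb : 0 < b) (n : ℕ) :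
    B a b * coef a b n = Real.Gamma (a + n) * Real.Gamma (b + n) /
      (Real.Gamma (a + b + n) * n.factorial) := by
  induction n with
  | zero => simp [coef_zero, B]
  | succ n ih =>
    rw [coef_succ, ← mul_assoc, ih, Nat.factorial_succ]
    push_cast
    rw [← add_assoc, ← add_assoc, ← add_assoc, Real.Gamma_add_one (by positivity),
      Real.Gamma_add_one (by positivity), Real.Gamma_add_one (by positivity)]
    have := (Real.Gamma_pos_of_pos (show 0 < a + b + n by positivity)).ne'
    field_simp

lemma B_mul_coef_antitone {a' : ℝ} (ha : 0 < a) (haa : a ≤ a') (hb : 0 < b) (n : ℕ) :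
    B a' b * coef a' b n ≤ B a b * coef a b n := by
  have ha' : 0 < a' := ha.trans_le haa
  rw [B_mul_coef ha hb, B_mul_coef ha' hb]
  have h := Gamma_mul_Gamma_le (x := a + n) (y := a' + n) (b := b) (by positivity) (by linarith) hb
  rw [add_right_comm a n b, add_right_comm a' n b] at h
  have g1 := Real.Gamma_pos_of_pos (show 0 < a + b + n by positivity)
  have g2 := Real.Gamma_pos_of_pos (show 0 < a' + b + n by positivity)
  have g3 := Real.Gamma_pos_of_pos (show 0 < b + n by positivity)
  have hf : (0 : ℝ) < n.factorial := by exact_mod_cast n.factorial_pos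
  rw [div_le_div_iff₀ (by positivity) (by positivity)]
  have := mul_le_mul_of_nonneg_right h (mul_pos g3 hf).le
  linarith

/-- Written this way, the effect of the shift a ↦ a + 1 telescopes in n. -/
lemma B_add_one_mul_coef (ha : 0 < a) (hb : 0 < b) (n : ℕ) :
    B a b * coef a b n - B (a + 1) b * coef (a + 1) b n =
      B a b / a * (((n : ℝ) + 1) * coef a b (n + 1) - n * coef a b n) := by
  rw [succ_mul_coef_succ_sub ha hb, B_mul_coef (by linarith : 0 < a + 1) hb]
  have h := B_mul_coef ha hb n
  have e : B a b / a * (a * b / (a + b + n) * coef a b n) =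
      b / (a + b + n) * (B a b * coef a b n) := by field_simp
  rw [e, h, add_right_comm a 1 (n : ℝ), add_right_comm a 1 b, add_right_comm (a + b) 1 (n : ℝ),
    Real.Gamma_add_one (by positivity), Real.Gamma_add_one (by positivity)]
  have := (Real.Gamma_pos_of_pos (show 0 < a + b + n by positivity)).ne'
  field_simp
  ring

lemma summable_ramanujanTerm (ha : 0 < a) (hb : 0 < b) : Summable (ramanujanTerm a b) := by
  obtain ⟨M, hM⟩ := exists_sub_nat_mul_coef_le ha hb
  have hB := B_pos ha hb
  rw [← summable_nat_add_iff 1]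
  have hsq : Summable fun n : ℕ => (B a b * M + 1) * (1 / ((n : ℝ) + 1) ^ 2) := by
    refine Summable.mul_left _ ?_
    have := (summable_nat_add_iff 1).2 (Real.summable_one_div_nat_pow.2 one_lt_two)
    simpa using this
  refine Summable.of_norm_bounded hsq fun n => ?_
  have hn : (0 : ℝ) < n + 1 := by positivity
  have h1 := hM n
  have h2 := nat_mul_coef_le ha hb (n + 1)
  push_cast at h2
  set v := ((n : ℝ) + 1) * coef a b (n + 1) with hv
  -- The first summand is O(1/n²) by the rate of convergence of n c_n; the second compares 1/(n+1)
  -- with 1/(n+2).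
  have e : ramanujanTerm a b (n + 1) = -(B a b * ((B a b)⁻¹ - v)) / (n + 1) +
      1 / ((n + 1) * (n + 2)) := by
    rw [ramanujanTerm, hv]
    push_cast
    field_simp
    ring
  have h3 : B a b * ((B a b)⁻¹ - v) / (n + 1) ≤ B a b * M * (1 / ((n : ℝ) + 1) ^ 2) := by
    calc _ ≤ B a b * (M / (n + 1)) / (n + 1) := by gcongr
      _ = _ := by field_simp
  have h4 : 0 ≤ B a b * ((B a b)⁻¹ - v) / (n + 1) :=
    div_nonneg (mul_nonneg hB.le (by linarith)) hn.le
  have h5 : 1 / (((n : ℝ) + 1) * (n + 2)) ≤ 1 / ((n : ℝ) + 1) ^ 2 := by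
    rw [sq]
    gcongr
    linarith
  have h6 : 0 ≤ 1 / (((n : ℝ) + 1) * (n + 2)) := by positivity
  have h7 : (0 : ℝ) ≤ 1 / ((n : ℝ) + 1) ^ 2 := by positivity
  rw [Real.norm_eq_abs, e, neg_div, abs_le]
  constructor <;> linarith

lemma tsum_ramanujanTerm_sub_add_one (ha : 0 < a) (hb : 0 < b) :
    ∑' n, ramanujanTerm a b n - ∑' n, ramanujanTerm (a + 1) b n = 1 / a := by
  have s1 := summable_ramanujanTerm ha hb
  have s2 := summable_ramanujanTerm (by linarith : 0 < a + 1) hb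
  rw [← s1.tsum_sub s2]
  have h1 := (s1.sub s2).hasSum.tendsto_sum_nat
  have h2 : Tendsto (fun n : ℕ => B a b / a * (n * coef a b n)) atTop
      (𝓝 (B a b / a * (B a b)⁻¹)) := (tendsto_nat_mul_coef ha hb).const_mul _
  have hB := (B_pos ha hb).ne'
  have e : B a b / a * (B a b)⁻¹ = 1 / a := by field_simp
  rw [e] at h2
  refine tendsto_nhds_unique h1 (h2.congr fun N => ?_)
  induction N with
  | zero => simp
  | succ N ih =>
    rw [Finset.sum_range_succ, ← ih, ramanujanTerm, ramanujanTerm, sub_sub_sub_cancel_right,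
      B_add_one_mul_coef ha hb]
    push_cast
    ring

lemma ramanujanTerm_comm (a b : ℝ) : ramanujanTerm a b = ramanujanTerm b a := by
  funext n
  rw [ramanujanTerm, ramanujanTerm, B_comm, coef_comm]

lemma tsum_ramanujanTerm_sub_R (ha : 0 < a) (hb : 0 < b) :
    ∑' n, ramanujanTerm a b n - R a b = ∑' n, ramanujanTerm 1 b n - R 1 b := by
  refine sub_eq_of_antitoneOn_of_sub_add_one (φ := fun a => ∑' n, ramanujanTerm a b n)
    (ψ := fun a => R a b) (fun x hx y hy hxy => ?_) (fun x hx y hy hxy => ?_)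
    (fun x hx => tsum_ramanujanTerm_sub_add_one hx hb) (fun x hx => ?_) ha
  · refine (summable_ramanujanTerm hy hb).tsum_le_tsum (fun n => ?_) (summable_ramanujanTerm hx hb)
    exact sub_le_sub_right (B_mul_coef_antitone hx hxy hb n) _
  · have := Psi_monotoneOn hx hy hxy
    simp only [R]
    linarith
  · simp only [R, Psi_add_one hx]
    ring

lemma coef_one_one (n : ℕ) : coef 1 1 n = 1 / ((n : ℝ) + 1) := by
  induction n with
  | zero => simp [coef_zero]
  | succ n ih =>
    rw [coef_succ, ih]
    push_cast
    field_simp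
    ring

lemma tsum_ramanujanTerm (ha : 0 < a) (hb : 0 < b) : ∑' n, ramanujanTerm a b n = R a b := by
  have h1 := tsum_ramanujanTerm_sub_R ha hb
  -- The first parameter has been moved to 1; symmetry now allows moving the second one as well. At
  -- (1,1) every term of the series vanishes, and so does R.
  have h2 := tsum_ramanujanTerm_sub_R hb one_pos
  have hR : R 1 b = R b 1 := by
    simp only [R]
    ring
  rw [ramanujanTerm_comm 1 b, hR, h2] at h1
  have h3 : ramanujanTerm 1 1 = fun _ => 0 := by
    funext n
    rw [ramanujanTerm, coef_one_one, B, one_add_one_eq_two]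
    simp
  have h4 : R 1 1 = 0 := by
    rw [R, Psi_one]
    ring
  rw [h3, tsum_zero, h4] at h1
  linarith

/-! ### Boundary behaviour of the series at `1` -/

lemma one_sub_mul_ser_dcoef (ha : 0 < a) (hb : 0 < b) (hab : a + b ≤ 1) {x : ℝ} (hx : |x| < 1) :
    (1 - x) * ser (dcoef (coef a b)) x =
      ser (fun n => a * b / (a + b + n) * coef a b n) x := by
  have hc := abs_coef_le_one ha hb hab
  rw [sub_mul, one_mul, mul_ser_dcoef hc hx]
  have hs : Summable fun n : ℕ => ((n : ℝ) * coef a b n) * x ^ n := by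
    refine summable_ser (p := fun n : ℕ => (n : ℝ) * coef a b n) (fun n => ?_) hx
    rw [abs_mul, Nat.abs_cast]
    have := mul_le_of_le_one_right (Nat.cast_nonneg (α := ℝ) n) (hc n)
    linarith
  rw [ser, ser, ser, ← (summable_ser (abs_dcoef_le hc) hx).tsum_sub hs]
  refine tsum_congr fun n => ?_
  rw [← succ_mul_coef_succ_sub ha hb, dcoef]
  ring

/-- The partial sums at x = 1 telescope to N c_N, so this is Abel's theorem. -/
lemma tendsto_ser_mul_coef (ha : 0 < a) (hb : 0 < b) :
    Tendsto (ser fun n => a * b / (a + b + n) * coef a b n) (𝓝[<] 1) (𝓝 (B a b)⁻¹) := by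
  refine Real.tendsto_tsum_powerSeries_nhdsWithin_lt
    ((tendsto_nat_mul_coef ha hb).congr fun N => ?_)
  induction N with
  | zero => simp
  | succ N ih =>
    rw [Finset.sum_range_succ, ← ih, ← succ_mul_coef_succ_sub ha hb]
    push_cast
    ring

/-- The function `-log (1 - x) / x`. -/
def logQuot (x : ℝ) : ℝ := -Real.log (1 - x) / x

lemma logQuot_eq_ser {x : ℝ} (hx0 : 0 < x) (hx : x < 1) :
    logQuot x = ser (fun n : ℕ => 1 / ((n : ℝ) + 1)) x := by
  have h := (Real.hasSum_pow_div_log_of_abs_lt_one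
    (x := x) (by rwa [abs_of_pos hx0])).div_const x
  rw [logQuot, ← h.tsum_eq, ser]
  refine tsum_congr fun n => ?_
  field_simp
  ring

lemma tendsto_B_mul_ser_coef_sub_logQuot (ha : 0 < a) (hb : 0 < b) (hab : a + b ≤ 1) :
    Tendsto (fun x => B a b * ser (coef a b) x - logQuot x) (𝓝[<] 1) (𝓝 (R a b)) := by
  have h := Real.tendsto_tsum_powerSeries_nhdsWithin_lt
    (summable_ramanujanTerm ha hb).hasSum.tendsto_sum_nat
  rw [tsum_ramanujanTerm ha hb] at h
  refine h.congr' ?_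
  filter_upwards [Ioo_mem_nhdsLT zero_lt_one] with x hx
  have hx' : |x| < 1 := by rw [abs_of_pos hx.1]; exact hx.2
  have s1 := summable_ser (abs_le_succ_of_abs_le_one (abs_coef_le_one ha hb hab)) hx'
  have s2 : Summable fun n : ℕ => 1 / ((n : ℝ) + 1) * x ^ n := by
    refine summable_ser (p := fun n : ℕ => 1 / ((n : ℝ) + 1))
      (abs_le_succ_of_abs_le_one fun n => ?_) hx'
    rw [abs_of_pos (by positivity), div_le_one (by positivity)]
    linarith [n.cast_nonneg (α := ℝ)]
  rw [logQuot_eq_ser hx.1 hx.2, ser, ser, ← tsum_mul_left, ← (s1.mul_left _).tsum_sub s2]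
  refine tsum_congr fun n => ?_
  rw [ramanujanTerm]
  ring

end

lemma continuousAt_ser {p : ℕ → ℝ} (hp : ∀ n, |p n| ≤ 1) {x : ℝ} (hx : |x| < 1) :
    ContinuousAt (ser p) x := (hasDerivAt_ser hp hx).continuousAt

lemma abs_lt_one_of_mem {x : ℝ} (hx : x ∈ Ioo (0 : ℝ) 1) : |x| < 1 := by
  rw [abs_of_pos hx.1]
  exact hx.2

lemma one_sub_mem_Ioo {x : ℝ} (hx : x ∈ Ioo (0 : ℝ) 1) : 1 - x ∈ Ioo (0 : ℝ) 1 :=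
  ⟨by linarith [hx.2], by linarith [hx.1]⟩

lemma tendsto_one_sub_nhdsGT : Tendsto (fun x : ℝ => 1 - x) (𝓝[>] 0) (𝓝[<] 1) := by
  refine tendsto_nhdsWithin_iff.2 ⟨?_, ?_⟩
  · have : Tendsto (fun x : ℝ => 1 - x) (𝓝 0) (𝓝 (1 - 0)) :=
      (continuous_const.sub continuous_id).tendsto 0
    rw [sub_zero] at this
    exact this.mono_left nhdsWithin_le_nhds
  · filter_upwards [self_mem_nhdsWithin] with x hx
    have : 0 < x := hx
    simpa using this

lemma tendsto_one_sub_nhdsLT : Tendsto (fun x : ℝ => 1 - x) (𝓝[<] 1) (𝓝[>] 0) := by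
  refine tendsto_nhdsWithin_iff.2 ⟨?_, ?_⟩
  · have : Tendsto (fun x : ℝ => 1 - x) (𝓝 1) (𝓝 (1 - 1)) :=
      (continuous_const.sub continuous_id).tendsto 1
    rw [sub_self] at this
    exact this.mono_left nhdsWithin_le_nhds
  · filter_upwards [self_mem_nhdsWithin] with x hx
    have : x < 1 := hx
    simpa using this

/-! ### The series `F(a, b; a + b; ·)` and `F(a, b; a + b + 1; ·)` -/

/-- `F(a, b; a + b; x)` as a power series. -/
def hyp (a b x : ℝ) : ℝ := ser (coef a b) x

/-- The coefficients of `F(a, b; a + b + 1; ·)`. -/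
def coefSucc (a b : ℝ) (n : ℕ) : ℝ := (a + b) / (a + b + n) * coef a b n

/-- `F(a, b; a + b + 1; x)` as a power series. -/
def hypSucc (a b x : ℝ) : ℝ := ser (coefSucc a b) x

section
variable {a b : ℝ}

lemma coefSucc_pos (ha : 0 < a) (hb : 0 < b) (n : ℕ) : 0 < coefSucc a b n := by
  have := coef_pos ha hb n
  rw [coefSucc]
  positivity

lemma coefSucc_le_coef (ha : 0 < a) (hb : 0 < b) (n : ℕ) : coefSucc a b n ≤ coef a b n := by
  refine mul_le_of_le_one_left (coef_pos ha hb n).le ?_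
  rw [div_le_one (by positivity)]
  linarith [n.cast_nonneg (α := ℝ)]

lemma abs_coefSucc_le_one (ha : 0 < a) (hb : 0 < b) (hab : a + b ≤ 1) (n : ℕ) :
    |coefSucc a b n| ≤ 1 := by
  rw [abs_of_pos (coefSucc_pos ha hb n)]
  exact (coefSucc_le_coef ha hb n).trans (coef_le_one ha hb hab n)

lemma hyp_pos (ha : 0 < a) (hb : 0 < b) (hab : a + b ≤ 1) {x : ℝ} (hx0 : 0 ≤ x) (hx : x < 1) :
    0 < hyp a b x := ser_pos (abs_coef_le_one ha hb hab) (coef_pos ha hb) hx0 hx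

lemma hypSucc_pos (ha : 0 < a) (hb : 0 < b) (hab : a + b ≤ 1) {x : ℝ} (hx0 : 0 ≤ x) (hx : x < 1) :
    0 < hypSucc a b x := ser_pos (abs_coefSucc_le_one ha hb hab) (coefSucc_pos ha hb) hx0 hx

lemma hypSucc_le_hyp (ha : 0 < a) (hb : 0 < b) (hab : a + b ≤ 1) {x : ℝ} (hx0 : 0 ≤ x)
    (hx : x < 1) : hypSucc a b x ≤ hyp a b x :=
  ser_le_ser (abs_coefSucc_le_one ha hb hab) (abs_coef_le_one ha hb hab)
    (coefSucc_le_coef ha hb) hx0 hx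

/-- F(a,b;a+b+1;·)/F(a,b;a+b;·) decreases because its coefficient quotients (a+b)/(a+b+n) do. The
sign of the derivative of `legendre` depends on this. -/
lemma hypSucc_mul_hyp_lt (ha : 0 < a) (hb : 0 < b) (hab : a + b ≤ 1) {x y : ℝ} (hx0 : 0 ≤ x)
    (hxy : x < y) (hy : y < 1) :
    hypSucc a b y * hyp a b x < hypSucc a b x * hyp a b y := by
  have key : ∀ n : ℕ, coefSucc a b (n + 1) * coef a b n < coefSucc a b n * coef a b (n + 1) := by
    intro n
    have h1 := coef_pos ha hb n
    have h2 := coef_pos ha hb (n + 1)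
    have h3 : (a + b) / (a + b + (n + 1)) < (a + b) / (a + b + n) :=
      div_lt_div_of_pos_left (by positivity) (by positivity) (by linarith)
    rw [coefSucc, coefSucc]
    push_cast
    have := mul_lt_mul_of_pos_right h3 (mul_pos h1 h2)
    linarith
  exact ser_mul_ser_lt (abs_coefSucc_le_one ha hb hab) (abs_coef_le_one ha hb hab)
    (coefSucc_pos ha hb) (coef_pos ha hb) (fun n => (key n).le) (key 0) hx0 hxy hy

lemma one_sub_mul_ser_dcoef_coef (ha : 0 < a) (hb : 0 < b) (hab : a + b ≤ 1) {x : ℝ}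
    (hx : |x| < 1) :
    (1 - x) * ser (dcoef (coef a b)) x = a * b / (a + b) * hypSucc a b x := by
  rw [one_sub_mul_ser_dcoef ha hb hab hx, hypSucc, ser, ser, ← tsum_mul_left]
  refine tsum_congr fun n => ?_
  rw [coefSucc]
  field_simp

lemma mul_ser_dcoef_coefSucc (ha : 0 < a) (hb : 0 < b) (hab : a + b ≤ 1) {x : ℝ} (hx : |x| < 1) :
    x * ser (dcoef (coefSucc a b)) x = (a + b) * (hyp a b x - hypSucc a b x) := by
  have hc := abs_coef_le_one ha hb hab
  have hg := abs_coefSucc_le_one ha hb hab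
  rw [mul_ser_dcoef hg hx, hyp, hypSucc, ser, ser, ser,
    ← (summable_ser (abs_le_succ_of_abs_le_one hc) hx).tsum_sub
      (summable_ser (abs_le_succ_of_abs_le_one hg) hx), ← tsum_mul_left]
  refine tsum_congr fun n => ?_
  rw [coefSucc]
  field_simp
  ring

lemma hasDerivAt_hyp (ha : 0 < a) (hb : 0 < b) (hab : a + b ≤ 1) {x : ℝ} (hx : x ∈ Ioo (0 : ℝ) 1) :
    HasDerivAt (hyp a b) (a * b / (a + b) * hypSucc a b x / (1 - x)) x := by
  have hx' := abs_lt_one_of_mem hx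
  refine (hasDerivAt_ser (abs_coef_le_one ha hb hab) hx').congr_deriv ?_
  rw [← one_sub_mul_ser_dcoef_coef ha hb hab hx', mul_div_cancel_left₀ _ (one_sub_mem_Ioo hx).1.ne']

lemma hasDerivAt_hypSucc (ha : 0 < a) (hb : 0 < b) (hab : a + b ≤ 1) {x : ℝ}
    (hx : x ∈ Ioo (0 : ℝ) 1) :
    HasDerivAt (hypSucc a b) ((a + b) * (hyp a b x - hypSucc a b x) / x) x := by
  have hx' := abs_lt_one_of_mem hx
  refine (hasDerivAt_ser (abs_coefSucc_le_one ha hb hab) hx').congr_deriv ?_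
  rw [← mul_ser_dcoef_coefSucc ha hb hab hx', mul_div_cancel_left₀ _ hx.1.ne']

lemma tendsto_hyp_nhdsGT_zero (ha : 0 < a) (hb : 0 < b) (hab : a + b ≤ 1) :
    Tendsto (hyp a b) (𝓝[>] 0) (𝓝 1) := by
  have h : Tendsto (hyp a b) (𝓝 0) (𝓝 (hyp a b 0)) :=
    continuousAt_ser (abs_coef_le_one ha hb hab) (by simp)
  rw [hyp, ser_zero, coef_zero] at h
  exact h.mono_left nhdsWithin_le_nhds

lemma continuousOn_hyp (ha : 0 < a) (hb : 0 < b) (hab : a + b ≤ 1) :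
    ContinuousOn (hyp a b) (Ico 0 1) := fun x hx =>
  (continuousAt_ser (abs_coef_le_one ha hb hab)
    (by rw [abs_of_nonneg hx.1]; exact hx.2)).continuousWithinAt

lemma tendsto_mul_hypSucc (ha : 0 < a) (hb : 0 < b) :
    Tendsto (fun x => a * b / (a + b) * hypSucc a b x) (𝓝[<] 1) (𝓝 (B a b)⁻¹) := by
  refine (tendsto_ser_mul_coef ha hb).congr fun x => ?_
  rw [hypSucc, ser, ser, ← tsum_mul_left]
  refine tsum_congr fun n => ?_
  rw [coefSucc]
  field_simp

lemma tendsto_log_one_sub_nhdsLT_one :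
    Tendsto (fun x : ℝ => -Real.log (1 - x)) (𝓝[<] 1) atTop :=
  tendsto_neg_atBot_atTop.comp (Real.tendsto_log_nhdsGT_zero.comp tendsto_one_sub_nhdsLT)

lemma tendsto_logQuot : Tendsto logQuot (𝓝[<] 1) atTop := by
  refine tendsto_atTop_mono' _ ?_ tendsto_log_one_sub_nhdsLT_one
  filter_upwards [Ioo_mem_nhdsLT zero_lt_one] with x hx
  have h : 0 ≤ -Real.log (1 - x) := by
    have := Real.log_nonpos (one_sub_mem_Ioo hx).1.le (one_sub_mem_Ioo hx).2.le
    linarith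
  rw [logQuot, le_div_iff₀ hx.1]
  exact mul_le_of_le_one_right h hx.2.le

lemma tendsto_hyp_div_logQuot (ha : 0 < a) (hb : 0 < b) (hab : a + b ≤ 1) :
    Tendsto (fun x => hyp a b x / logQuot x) (𝓝[<] 1) (𝓝 (B a b)⁻¹) := by
  have h := (((tendsto_B_mul_ser_coef_sub_logQuot ha hb hab).div_atTop
    tendsto_logQuot).add_const 1).const_mul (B a b)⁻¹
  rw [zero_add, mul_one] at h
  refine h.congr' ?_
  filter_upwards [tendsto_logQuot.eventually_gt_atTop 0] with x hx
  have := (B_pos ha hb).ne'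
  rw [hyp]
  field_simp
  ring

lemma tendsto_hyp_nhdsLT_one (ha : 0 < a) (hb : 0 < b) (hab : a + b ≤ 1) :
    Tendsto (hyp a b) (𝓝[<] 1) atTop := by
  have h := (tendsto_hyp_div_logQuot ha hb hab).pos_mul_atTop (inv_pos.2 (B_pos ha hb))
    tendsto_logQuot
  refine h.congr' ?_
  filter_upwards [tendsto_logQuot.eventually_gt_atTop 0] with x hx
  exact div_mul_cancel₀ _ hx.ne'

/-- F grows only logarithmically at 1, while √t log t → 0 as t → 0. -/
lemma tendsto_sqrt_mul_hyp (ha : 0 < a) (hb : 0 < b) (hab : a + b ≤ 1) :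
    Tendsto (fun x => √(1 - x) * hyp a b x) (𝓝[<] 1) (𝓝 0) := by
  have h1 : Tendsto (fun x : ℝ => √x * Real.log x) (𝓝[>] 0) (𝓝 0) := by
    refine (tendsto_log_mul_rpow_nhdsGT_zero (r := 1 / 2) (by norm_num)).congr fun x => ?_
    rw [Real.sqrt_eq_rpow, mul_comm]
  have h2 := h1.comp tendsto_one_sub_nhdsLT
  have hid : Tendsto (fun x : ℝ => x) (𝓝[<] 1) (𝓝 1) := tendsto_id.mono_left nhdsWithin_le_nhds
  have h3 := ((h2.neg.div hid one_ne_zero).mul (tendsto_hyp_div_logQuot ha hb hab))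
  rw [neg_zero, zero_div, zero_mul] at h3
  refine h3.congr' ?_
  filter_upwards [tendsto_logQuot.eventually_gt_atTop 0, Ioo_mem_nhdsLT zero_lt_one] with x hx hx'
  have h4 : Real.log (1 - x) = -(logQuot x * x) := by
    rw [logQuot, div_mul_cancel₀ _ hx'.1.ne', neg_neg]
  have := hx'.1.ne'
  simp only [Pi.div_apply, Function.comp_apply]
  rw [h4]
  field_simp

lemma four_mul_le (ha : 0 < a) (hb : 0 < b) (hab : a + b ≤ 1) : 4 * (a * b / (a + b)) ≤ 1 := by
  rw [← mul_div_assoc, div_le_one (by positivity)]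
  nlinarith [sq_nonneg (a - b)]

/-- With G = `hypSucc a b` and k = ab/(a+b), the derivative is -F(F - 2kG), and 4k ≤ 1, G ≤ F. -/
lemma one_sub_mul_hyp_sq_strictAntiOn (ha : 0 < a) (hb : 0 < b) (hab : a + b ≤ 1) :
    StrictAntiOn (fun x => (1 - x) * hyp a b x ^ 2) (Ico 0 1) := by
  refine strictAntiOn_of_deriv_neg (convex_Ico 0 1) ?_ fun x hx => ?_
  · exact (continuousOn_const.sub continuousOn_id).mul ((continuousOn_hyp ha hb hab).pow 2)
  · rw [interior_Ico] at hx
    have hd := ((hasDerivAt_id x).const_sub 1).mul ((hasDerivAt_hyp ha hb hab hx).pow 2)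
    have hd' : deriv (fun x => (1 - x) * hyp a b x ^ 2) x = _ := hd.deriv
    have h1 := (one_sub_mem_Ioo hx).1.ne'
    have e : -1 * hyp a b x ^ 2 + (1 - x) * (2 * hyp a b x *
        (a * b / (a + b) * hypSucc a b x / (1 - x))) =
        -hyp a b x * (hyp a b x - 2 * (a * b / (a + b)) * hypSucc a b x) := by
      field_simp
      ring
    have hF := hyp_pos ha hb hab hx.1.le hx.2
    have hG := hypSucc_pos ha hb hab hx.1.le hx.2
    have hGF := hypSucc_le_hyp ha hb hab hx.1.le hx.2
    have hk := four_mul_le ha hb hab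
    have hlt : 0 < hyp a b x - 2 * (a * b / (a + b)) * hypSucc a b x := by nlinarith
    have := mul_pos hF hlt
    rw [hd']
    simp only [id, Pi.pow_apply, Nat.cast_ofNat, Nat.add_one_sub_one, pow_one]
    linarith

/-! ### The generalized Legendre function -/

/-- `x (1 - x) (F'(x) F(1 - x) - F(x) (F(1 - x))')` for `F = F(a, b; a + b; ·)`. -/
def legendre (a b x : ℝ) : ℝ :=
  a * b / (a + b) * ((1 - x) * hypSucc a b (1 - x) * hyp a b x
    + x * hypSucc a b x * hyp a b (1 - x))

lemma legendre_one_sub (a b x : ℝ) : legendre a b (1 - x) = legendre a b x := by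
  rw [legendre, legendre, sub_sub_cancel]
  ring

lemma hasDerivAt_hyp_one_sub (ha : 0 < a) (hb : 0 < b) (hab : a + b ≤ 1) {x : ℝ}
    (hx : x ∈ Ioo (0 : ℝ) 1) :
    HasDerivAt (fun x => hyp a b (1 - x)) (-(a * b / (a + b) * hypSucc a b (1 - x) / x)) x := by
  have h := (hasDerivAt_hyp ha hb hab (one_sub_mem_Ioo hx)).comp_const_sub 1 x
  rwa [sub_sub_cancel] at h

lemma hasDerivAt_legendre (ha : 0 < a) (hb : 0 < b) (hab : a + b ≤ 1) {x : ℝ}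
    (hx : x ∈ Ioo (0 : ℝ) 1) :
    HasDerivAt (legendre a b) (a * b / (a + b) * (1 - (a + b)) *
      (hypSucc a b x * hyp a b (1 - x) - hypSucc a b (1 - x) * hyp a b x)) x := by
  have hF := hasDerivAt_hyp ha hb hab hx
  have hG := hasDerivAt_hypSucc ha hb hab hx
  have hF' := hasDerivAt_hyp_one_sub ha hb hab hx
  have hG' := (hasDerivAt_hypSucc ha hb hab (one_sub_mem_Ioo hx)).comp_const_sub 1 x
  have hd := (((((hasDerivAt_id x).const_sub 1).mul hG').mul hF).add
    (((hasDerivAt_id x).mul hG).mul hF')).const_mul (a * b / (a + b))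
  refine hd.congr_deriv ?_
  have h1 := (one_sub_mem_Ioo hx).1.ne'
  have h0 := hx.1.ne'
  simp only [id, Pi.mul_apply]
  field_simp
  ring

lemma legendre_monotoneOn (ha : 0 < a) (hb : 0 < b) (hab : a + b ≤ 1) :
    MonotoneOn (legendre a b) (Ioc 0 (1 / 2)) := by
  have hsub : ∀ {x : ℝ}, x ∈ Ioc (0 : ℝ) (1 / 2) → x ∈ Ioo (0 : ℝ) 1 := fun hx =>
    ⟨hx.1, by linarith [hx.2]⟩
  refine monotoneOn_of_deriv_nonneg (convex_Ioc 0 (1 / 2))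
    (fun x hx => (hasDerivAt_legendre ha hb hab (hsub hx)).continuousAt.continuousWithinAt)
    (fun x hx => (hasDerivAt_legendre ha hb hab
      (hsub (interior_subset hx))).differentiableAt.differentiableWithinAt) fun x hx => ?_
  rw [interior_Ioc] at hx
  rw [(hasDerivAt_legendre ha hb hab ⟨hx.1, by linarith [hx.2]⟩).deriv]
  have := hypSucc_mul_hyp_lt ha hb hab hx.1.le (by linarith [hx.2] : x < 1 - x)
    (by linarith [hx.1])
  refine mul_nonneg (mul_nonneg (by positivity) (by linarith)) (by linarith)

lemma tendsto_legendre (ha : 0 < a) (hb : 0 < b) (hab : a + b ≤ 1) :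
    Tendsto (legendre a b) (𝓝[>] 0) (𝓝 (B a b)⁻¹) := by
  have hx : Tendsto (fun x : ℝ => x) (𝓝[>] 0) (𝓝 0) := tendsto_id.mono_left nhdsWithin_le_nhds
  have h1 := (((hx.const_sub 1).mul ((tendsto_mul_hypSucc ha hb).comp tendsto_one_sub_nhdsGT)).mul
    (tendsto_hyp_nhdsGT_zero ha hb hab))
  have hsqrt : Tendsto (fun x : ℝ => √x) (𝓝[>] 0) (𝓝 0) := by
    have := (Real.continuous_sqrt.tendsto 0).mono_left (nhdsWithin_le_nhds (s := Ioi 0))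
    rwa [Real.sqrt_zero] at this
  have hG : Tendsto (hypSucc a b) (𝓝[>] 0) (𝓝 (hypSucc a b 0)) :=
    Tendsto.mono_left (continuousAt_ser (abs_coefSucc_le_one ha hb hab) (by simp))
      nhdsWithin_le_nhds
  -- In x F(1-x) G(x) the factor x is split as √x · √x; one root absorbs the blow-up of F(1-x), the
  -- other tends to 0.
  have h2 := ((hsqrt.mul ((tendsto_sqrt_mul_hyp ha hb hab).comp tendsto_one_sub_nhdsGT)).mul
    hG).const_mul (a * b / (a + b))
  have h := h1.add h2
  simp only [sub_zero, one_mul, mul_one, zero_mul, mul_zero, add_zero] at h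
  refine h.congr' ?_
  filter_upwards [self_mem_nhdsWithin] with x hx
  simp only [Function.comp_apply, legendre, sub_sub_cancel]
  have : √x * (√x * hyp a b (1 - x)) = x * hyp a b (1 - x) := by
    rw [← mul_assoc, Real.mul_self_sqrt (le_of_lt hx)]
  rw [this]
  ring

/-- On (0,1/2] monotonicity bounds `legendre` below by its limit at 0; the symmetry x ↦ 1 - x
carries the bound to the other half. -/
lemma inv_B_le_legendre (ha : 0 < a) (hb : 0 < b) (hab : a + b ≤ 1) {x : ℝ}
    (hx : x ∈ Ioo (0 : ℝ) 1) : (B a b)⁻¹ ≤ legendre a b x := by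
  have key : ∀ {y : ℝ}, y ∈ Ioc (0 : ℝ) (1 / 2) → (B a b)⁻¹ ≤ legendre a b y := fun {y} hy => by
    refine le_of_tendsto (tendsto_legendre ha hb hab) ?_
    filter_upwards [Ioo_mem_nhdsGT hy.1] with z hz
    exact legendre_monotoneOn ha hb hab ⟨hz.1, hz.2.le.trans hy.2⟩ hy hz.2.le
  rcases le_total x (1 / 2) with h | h
  · exact key ⟨hx.1, h⟩
  · rw [← legendre_one_sub]
    exact key ⟨(one_sub_mem_Ioo hx).1, by linarith⟩

/-- The quotient `F(1 - x) / F(x)`. -/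
def hypRatio (a b x : ℝ) : ℝ := hyp a b (1 - x) / hyp a b x

lemma hasDerivAt_hypRatio (ha : 0 < a) (hb : 0 < b) (hab : a + b ≤ 1) {x : ℝ}
    (hx : x ∈ Ioo (0 : ℝ) 1) :
    HasDerivAt (hypRatio a b) (-(legendre a b x / (x * (1 - x) * hyp a b x ^ 2))) x := by
  have hF := (hyp_pos ha hb hab hx.1.le hx.2).ne'
  refine ((hasDerivAt_hyp_one_sub ha hb hab hx).div (hasDerivAt_hyp ha hb hab hx) hF).congr_deriv ?_
  have h1 := (one_sub_mem_Ioo hx).1.ne'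
  have h0 := hx.1.ne'
  rw [legendre]
  field_simp
  ring

end

/-! ### Quotients `φ (1 - x) / ψ x` of normalized decreasing functions -/

/-- A continuous positive strictly decreasing function on `(0, 1)` with limits `1` at `0` and `l`
at `1`. -/
structure NormalizedAnti (φ : ℝ → ℝ) (l : ℝ) : Prop where
  continuousOn : ContinuousOn φ (Ioo 0 1)
  strictAntiOn : StrictAntiOn φ (Ioo 0 1)
  pos : ∀ x ∈ Ioo (0 : ℝ) 1, 0 < φ x
  tendsto_zero : Tendsto φ (𝓝[>] 0) (𝓝 1)
  tendsto_one : Tendsto φ (𝓝[<] 1) (𝓝 l)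

lemma sq_mem_Ioo {r : ℝ} (hr : r ∈ Ioo (0 : ℝ) 1) : r ^ 2 ∈ Ioo (0 : ℝ) 1 :=
  ⟨pow_pos hr.1 2, pow_lt_one₀ hr.1.le hr.2 two_ne_zero⟩

lemma tendsto_sq_nhdsGT_zero : Tendsto (fun r : ℝ => r ^ 2) (𝓝[>] 0) (𝓝[>] 0) := by
  refine tendsto_nhdsWithin_iff.2 ⟨?_, ?_⟩
  · have := (continuous_pow (M := ℝ) 2).tendsto 0
    rw [zero_pow two_ne_zero] at this
    exact this.mono_left nhdsWithin_le_nhds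
  · filter_upwards [self_mem_nhdsWithin] with r hr
    exact pow_pos (show (0 : ℝ) < r from hr) 2

lemma tendsto_sq_nhdsLT_one : Tendsto (fun r : ℝ => r ^ 2) (𝓝[<] 1) (𝓝[<] 1) := by
  refine tendsto_nhdsWithin_iff.2 ⟨?_, ?_⟩
  · have := (continuous_pow (M := ℝ) 2).tendsto 1
    rw [one_pow] at this
    exact this.mono_left nhdsWithin_le_nhds
  · filter_upwards [Ioo_mem_nhdsLT zero_lt_one] with r hr
    exact (sq_mem_Ioo hr).2

section
variable {φ ψ f : ℝ → ℝ} {l l' C : ℝ}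

/-- As r grows, 1 - r² decreases and r² increases, so the numerator rises and the denominator falls.
This and the limit lemmas below serve `f₂` to `f₅`. -/
lemma NormalizedAnti.strictMonoOn_div (hφ : NormalizedAnti φ l) (hψ : NormalizedAnti ψ l')
    (hC : 0 < C) (hf : ∀ r ∈ Ioo (0 : ℝ) 1, f r = C * (φ (1 - r ^ 2) / ψ (r ^ 2))) :
    StrictMonoOn f (Ioo 0 1) := fun r hr s hs hrs => by
  have h2 : r ^ 2 < s ^ 2 := pow_lt_pow_left₀ hrs hr.1.le two_ne_zero
  have hr2 := sq_mem_Ioo hr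
  have hs2 := sq_mem_Ioo hs
  rw [hf r hr, hf s hs]
  refine mul_lt_mul_of_pos_left ?_ hC
  exact div_lt_div₀ (hφ.strictAntiOn (one_sub_mem_Ioo hs2) (one_sub_mem_Ioo hr2) (by linarith))
    (hψ.strictAntiOn hr2 hs2 h2).le (hφ.pos _ (one_sub_mem_Ioo hs2)).le (hψ.pos _ hs2)

lemma NormalizedAnti.continuousOn_div (hφ : NormalizedAnti φ l) (hψ : NormalizedAnti ψ l')
    (hf : ∀ r ∈ Ioo (0 : ℝ) 1, f r = C * (φ (1 - r ^ 2) / ψ (r ^ 2))) :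
    ContinuousOn f (Ioo 0 1) := by
  refine ContinuousOn.congr (continuousOn_const.mul (ContinuousOn.div
    (hφ.continuousOn.comp (continuousOn_const.sub (continuousOn_pow 2)) fun r hr =>
      one_sub_mem_Ioo (sq_mem_Ioo hr))
    (hψ.continuousOn.comp (continuousOn_pow 2) fun r hr => sq_mem_Ioo hr)
    fun r hr => (hψ.pos _ (sq_mem_Ioo hr)).ne')) hf

lemma NormalizedAnti.tendsto_div_zero (hφ : NormalizedAnti φ l) (hψ : NormalizedAnti ψ l')
    (hf : ∀ r ∈ Ioo (0 : ℝ) 1, f r = C * (φ (1 - r ^ 2) / ψ (r ^ 2))) :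
    Tendsto f (𝓝[>] 0) (𝓝 (C * l)) := by
  have h := (((hφ.tendsto_one.comp tendsto_one_sub_nhdsGT).div hψ.tendsto_zero one_ne_zero).comp
    tendsto_sq_nhdsGT_zero).const_mul C
  rw [div_one] at h
  refine h.congr' ?_
  filter_upwards [Ioo_mem_nhdsGT zero_lt_one] with r hr
  exact (hf r hr).symm

lemma NormalizedAnti.tendsto_div_one (hφ : NormalizedAnti φ l) (hψ : NormalizedAnti ψ l')
    (hl' : l' ≠ 0) (hf : ∀ r ∈ Ioo (0 : ℝ) 1, f r = C * (φ (1 - r ^ 2) / ψ (r ^ 2))) :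
    Tendsto f (𝓝[<] 1) (𝓝 (C / l')) := by
  have h := (((hφ.tendsto_zero.comp tendsto_one_sub_nhdsLT).div hψ.tendsto_one hl').comp
    tendsto_sq_nhdsLT_one).const_mul C
  rw [mul_one_div] at h
  refine h.congr' ?_
  filter_upwards [Ioo_mem_nhdsLT zero_lt_one] with r hr
  exact (hf r hr).symm

lemma NormalizedAnti.tendsto_div_one_atTop (hφ : NormalizedAnti φ l) (hψ : NormalizedAnti ψ 0)
    (hC : 0 < C) (hf : ∀ r ∈ Ioo (0 : ℝ) 1, f r = C * (φ (1 - r ^ 2) / ψ (r ^ 2))) :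
    Tendsto f (𝓝[<] 1) atTop := by
  have hψ' : Tendsto ψ (𝓝[<] 1) (𝓝[>] 0) := tendsto_nhdsWithin_iff.2 ⟨hψ.tendsto_one, by
    filter_upwards [Ioo_mem_nhdsLT zero_lt_one] with x hx using hψ.pos x hx⟩
  have h := (((hφ.tendsto_zero.comp tendsto_one_sub_nhdsLT).pos_mul_atTop one_pos
    (tendsto_inv_nhdsGT_zero.comp hψ')).comp tendsto_sq_nhdsLT_one).const_mul_atTop hC
  refine h.congr' ?_
  filter_upwards [Ioo_mem_nhdsLT zero_lt_one] with r hr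
  rw [hf r hr, div_eq_mul_inv]
  rfl

end

/-! ### Images of strictly monotone functions -/

section
variable {f : ℝ → ℝ} {p q l l' : ℝ}

lemma lt_of_strictMonoOn_of_tendsto_left (hm : StrictMonoOn f (Ioo p q))
    (h : Tendsto f (𝓝[>] p) (𝓝 l)) {x : ℝ} (hx : x ∈ Ioo p q) : l < f x := by
  obtain ⟨y, hpy, hyx⟩ := exists_between hx.1
  have hy : y ∈ Ioo p q := ⟨hpy, hyx.trans hx.2⟩
  refine lt_of_le_of_lt (le_of_tendsto h ?_) (hm hy hx hyx)
  filter_upwards [Ioo_mem_nhdsGT hpy] with z hz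
  exact (hm ⟨hz.1, hz.2.trans hy.2⟩ hy hz.2).le

lemma lt_of_strictMonoOn_of_tendsto_right (hm : StrictMonoOn f (Ioo p q))
    (h : Tendsto f (𝓝[<] q) (𝓝 l)) {x : ℝ} (hx : x ∈ Ioo p q) : f x < l := by
  obtain ⟨y, hxy, hyq⟩ := exists_between hx.2
  have hy : y ∈ Ioo p q := ⟨hx.1.trans hxy, hyq⟩
  refine lt_of_lt_of_le (hm hx hy hxy) (ge_of_tendsto h ?_)
  filter_upwards [Ioo_mem_nhdsLT hyq] with z hz
  exact (hm hy ⟨hy.1.trans hz.1, hz.2⟩ hz.1).le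

lemma image_Ioo_eq_Ioo (hpq : p < q) (hc : ContinuousOn f (Ioo p q))
    (hm : StrictMonoOn f (Ioo p q)) (h0 : Tendsto f (𝓝[>] p) (𝓝 l))
    (h1 : Tendsto f (𝓝[<] q) (𝓝 l')) : f '' Ioo p q = Ioo l l' := by
  refine Subset.antisymm ?_ ?_
  · rintro _ ⟨x, hx, rfl⟩
    exact ⟨lt_of_strictMonoOn_of_tendsto_left hm h0 hx,
      lt_of_strictMonoOn_of_tendsto_right hm h1 hx⟩
  · exact isPreconnected_Ioo.intermediate_value_Ioo (le_principal_iff.2 (Ioo_mem_nhdsGT hpq))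
      (le_principal_iff.2 (Ioo_mem_nhdsLT hpq)) hc h0 h1

lemma image_Ioo_eq_Ioi (hpq : p < q) (hc : ContinuousOn f (Ioo p q))
    (hm : StrictMonoOn f (Ioo p q)) (h0 : Tendsto f (𝓝[>] p) (𝓝 l))
    (h1 : Tendsto f (𝓝[<] q) atTop) : f '' Ioo p q = Ioi l := by
  refine Subset.antisymm ?_ ?_
  · rintro _ ⟨x, hx, rfl⟩
    exact lt_of_strictMonoOn_of_tendsto_left hm h0 hx
  · exact isPreconnected_Ioo.intermediate_value_Ioi (le_principal_iff.2 (Ioo_mem_nhdsGT hpq))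
      (le_principal_iff.2 (Ioo_mem_nhdsLT hpq)) hc h0 h1

lemma image_Ico_eq_Ico (hpq : p < q) (hc : ContinuousOn f (Ico p q))
    (hm : StrictMonoOn f (Ico p q)) (h1 : Tendsto f (𝓝[<] q) (𝓝 l')) :
    f '' Ico p q = Ico (f p) l' := by
  have hmem : p ∈ Ico p q := ⟨le_rfl, hpq⟩
  refine Subset.antisymm ?_ ?_
  · rintro _ ⟨x, hx, rfl⟩
    refine ⟨hm.monotoneOn hmem hx hx.1, ?_⟩
    obtain ⟨y, hxy, hyq⟩ := exists_between hx.2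
    have hy : y ∈ Ico p q := ⟨hx.1.trans hxy.le, hyq⟩
    refine (hm hx hy hxy).trans ?_
    exact lt_of_strictMonoOn_of_tendsto_right (hm.mono Ioo_subset_Ico_self) h1
      ⟨hx.1.trans_lt hxy, hyq⟩
  · exact isPreconnected_Ico.intermediate_value_Ico hmem
      (le_principal_iff.2 (mem_of_superset (Ioo_mem_nhdsLT hpq) Ioo_subset_Ico_self)) hc h1

lemma strictMonoOn_update (hm : StrictMonoOn f (Ioo p q)) (h1 : Tendsto f (𝓝[<] q) (𝓝 l')) :
    StrictMonoOn (Function.update f q l') (Ioc p q) := fun x hx y hy hxy => by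
  have hxq : x < q := hxy.trans_le hy.2
  rw [Function.update_of_ne hxq.ne]
  rcases hy.2.eq_or_lt with rfl | hyq
  · rw [Function.update_self]
    exact lt_of_strictMonoOn_of_tendsto_right hm h1 ⟨hx.1, hxq⟩
  · rw [Function.update_of_ne hyq.ne]
    exact hm ⟨hx.1, hxq⟩ ⟨hy.1, hyq⟩ hxy

lemma image_update_Ioc (hpq : p < q) : Function.update f q l' '' Ioc p q =
    insert l' (f '' Ioo p q) := by
  rw [← Ioo_insert_right hpq, image_insert_eq, Function.update_self]
  congr 1
  exact image_congr fun x hx => Function.update_of_ne hx.2.ne _ _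

lemma image_update_Ioc_eq_Ioc (hpq : p < q) (hc : ContinuousOn f (Ioo p q))
    (hm : StrictMonoOn f (Ioo p q)) (h0 : Tendsto f (𝓝[>] p) (𝓝 l))
    (h1 : Tendsto f (𝓝[<] q) (𝓝 l')) : Function.update f q l' '' Ioc p q = Ioc l l' := by
  obtain ⟨x, hx⟩ := exists_between hpq
  have hl : l < l' := (lt_of_strictMonoOn_of_tendsto_left hm h0 hx).trans
    (lt_of_strictMonoOn_of_tendsto_right hm h1 hx)
  rw [image_update_Ioc hpq, image_Ioo_eq_Ioo hpq hc hm h0 h1, Ioo_insert_right hl]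

end

/-! ### The normalized decreasing functions attached to `F(a, b; a + b; ·)` -/

/-- The function `artanh √x / √x`. -/
def artanhQuot (x : ℝ) : ℝ := Real.artanh √x / √x

lemma sqrt_mem_Ioo {x : ℝ} (hx : x ∈ Ioo (0 : ℝ) 1) : √x ∈ Ioo (0 : ℝ) 1 :=
  ⟨Real.sqrt_pos.2 hx.1, by rw [Real.sqrt_lt' one_pos, one_pow]; exact hx.2⟩

lemma artanh_sqrt {x : ℝ} (hx : x ∈ Ioo (0 : ℝ) 1) :
    Real.artanh √x = Real.log (1 + √x) - 1 / 2 * Real.log (1 - x) := by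
  have hs := sqrt_mem_Ioo hx
  have h1 : 0 < 1 + √x := by linarith [hs.1]
  have h2 : 0 < 1 - √x := by linarith [hs.2]
  have h3 : 1 - x = (1 + √x) * (1 - √x) := by
    have := Real.sq_sqrt hx.1.le
    linarith
  rw [Real.artanh_eq_half_log ⟨by linarith [hs.1], hs.2.le⟩, Real.log_div h1.ne' h2.ne', h3,
    Real.log_mul h1.ne' h2.ne']
  ring

lemma artanhQuot_eq_ser {x : ℝ} (hx : x ∈ Ioo (0 : ℝ) 1) :
    artanhQuot x = ser (fun n : ℕ => 1 / (2 * (n : ℝ) + 1)) x := by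
  have hs := sqrt_mem_Ioo hx
  have h1 : 0 < 1 + √x := by linarith [hs.1]
  have h2 : 0 < 1 - √x := by linarith [hs.2]
  have h := (Real.hasSum_log_sub_log_of_abs_lt_one (abs_lt_one_of_mem hs)).div_const (2 * √x)
  have e : artanhQuot x = (Real.log (1 + √x) - Real.log (1 - √x)) / (2 * √x) := by
    rw [artanhQuot, Real.artanh_eq_half_log ⟨by linarith [hs.1], hs.2.le⟩,
      Real.log_div h1.ne' h2.ne']
    have := hs.1.ne'
    field_simp
  rw [e, ← h.tsum_eq, ser]
  refine tsum_congr fun n => ?_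
  have hx2 : √x ^ (2 * n + 1) = x ^ n * √x := by
    rw [pow_succ, pow_mul, Real.sq_sqrt hx.1.le]
  have := hs.1.ne'
  rw [hx2]
  field_simp

section
variable {a b : ℝ}

lemma normalizedAnti_hyp_div_ser (ha : 0 < a) (hb : 0 < b) (hab : a + b ≤ 1) {q : ℕ → ℝ}
    (hq1 : ∀ n, |q n| ≤ 1) (hq : ∀ n, 0 < q n) (hq0 : q 0 = 1)
    (h : ∀ n, coef a b (n + 1) * q n < coef a b n * q (n + 1)) {l : ℝ}
    (hl : Tendsto (fun x => hyp a b x / ser q x) (𝓝[<] 1) (𝓝 l)) :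
    NormalizedAnti (fun x => hyp a b x / ser q x) l where
  continuousOn := ((continuousOn_hyp ha hb hab).mono Ioo_subset_Ico_self).div
    (fun x hx => (continuousAt_ser hq1 (abs_lt_one_of_mem hx)).continuousWithinAt)
    fun x hx => (ser_pos hq1 hq hx.1.le hx.2).ne'
  strictAntiOn x hx y hy hxy := by
    simp only
    rw [div_lt_div_iff₀ (ser_pos hq1 hq hy.1.le hy.2) (ser_pos hq1 hq hx.1.le hx.2)]
    exact ser_mul_ser_lt (abs_coef_le_one ha hb hab) hq1 (coef_pos ha hb) hq (fun n => (h n).le)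
      (h 0) hx.1.le hxy hy.2
  pos x hx := div_pos (hyp_pos ha hb hab hx.1.le hx.2) (ser_pos hq1 hq hx.1.le hx.2)
  tendsto_zero := by
    have h1 : Tendsto (ser q) (𝓝[>] 0) (𝓝 (ser q 0)) :=
      Tendsto.mono_left (continuousAt_ser hq1 (by simp)) nhdsWithin_le_nhds
    rw [ser_zero, hq0] at h1
    have h2 := (tendsto_hyp_nhdsGT_zero ha hb hab).div h1 one_ne_zero
    rwa [div_one] at h2
  tendsto_one := hl

lemma NormalizedAnti.congr {φ ψ : ℝ → ℝ} {l : ℝ} (hφ : NormalizedAnti φ l)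
    (h : EqOn ψ φ (Ioo 0 1)) : NormalizedAnti ψ l where
  continuousOn := hφ.continuousOn.congr h
  strictAntiOn := hφ.strictAntiOn.congr h.symm
  pos x hx := by
    rw [h hx]
    exact hφ.pos x hx
  tendsto_zero := hφ.tendsto_zero.congr' (h.symm.eventuallyEq_of_mem (Ioo_mem_nhdsGT zero_lt_one))
  tendsto_one := hφ.tendsto_one.congr' (h.symm.eventuallyEq_of_mem (Ioo_mem_nhdsLT zero_lt_one))

lemma normalizedAnti_hyp_div_logQuot (ha : 0 < a) (hb : 0 < b) (hab : a + b ≤ 1) :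
    NormalizedAnti (fun x => hyp a b x / logQuot x) (B a b)⁻¹ := by
  have he : EqOn (fun x => hyp a b x / logQuot x)
      (fun x => hyp a b x / ser (fun n : ℕ => 1 / ((n : ℝ) + 1)) x) (Ioo 0 1) := fun x hx => by
    simp only [logQuot_eq_ser hx.1 hx.2]
  refine (normalizedAnti_hyp_div_ser ha hb hab (fun n => ?_) (fun n => by positivity) (by simp)
    (fun n => ?_) ((tendsto_hyp_div_logQuot ha hb hab).congr'
      (he.eventuallyEq_of_mem (Ioo_mem_nhdsLT zero_lt_one)))).congr he
  · rw [abs_of_pos (by positivity), div_le_one (by positivity)]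
    linarith [n.cast_nonneg (α := ℝ)]
  · have hc := coef_pos ha hb n
    have hn := n.cast_nonneg (α := ℝ)
    rw [coef_succ, mul_assoc]
    refine mul_lt_mul_of_pos_left ?_ hc
    push_cast
    rw [mul_one_div, div_div, div_lt_div_iff₀ (by positivity) (by positivity)]
    -- After clearing denominators the claim is (1 - ab)n + (a+b) - 2ab > 0, and a + b ≤ 1 makes ab
    -- small enough.
    have h1 : a * b ≤ (a + b) / 4 := by nlinarith [sq_nonneg (a - b)]
    have h2 : a * b * n ≤ (a + b) / 4 * n := by gcongr
    nlinarith

/-- In artanh √x = log(1+√x) - ½ log(1-x) only the second term is unbounded, so artanh √x is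
asymptotic to -½ log(1-x). -/
lemma tendsto_logQuot_div_artanhQuot :
    Tendsto (fun x => logQuot x / artanhQuot x) (𝓝[<] 1) (𝓝 2) := by
  have hid : Tendsto (fun x : ℝ => x) (𝓝[<] 1) (𝓝 1) := tendsto_id.mono_left nhdsWithin_le_nhds
  have hs : Tendsto (fun x : ℝ => √x) (𝓝[<] 1) (𝓝 1) := by
    have := (Real.continuous_sqrt.tendsto 1).mono_left (nhdsWithin_le_nhds (s := Iio 1))
    rwa [Real.sqrt_one] at this
  have hl : Tendsto (fun x : ℝ => Real.log (1 + √x)) (𝓝[<] 1) (𝓝 (Real.log (1 + 1))) :=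
    (hs.const_add 1).log (by norm_num)
  have h1 := (hl.div_atTop tendsto_log_one_sub_nhdsLT_one).add_const (1 / 2)
  have h2 := hs.div (hid.mul h1) (by norm_num)
  have e : (1 : ℝ) / (1 * (0 + 1 / 2)) = 2 := by norm_num
  rw [e] at h2
  refine h2.congr' ?_
  filter_upwards [tendsto_log_one_sub_nhdsLT_one.eventually_gt_atTop 0,
    Ioo_mem_nhdsLT zero_lt_one] with x hx hx'
  have h3 := (sqrt_mem_Ioo hx').1.ne'
  have h4 := hx'.1.ne'
  have e2 : Real.log (1 + √x) / -Real.log (1 - x) + 1 / 2 =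
      Real.artanh √x / -Real.log (1 - x) := by
    rw [artanh_sqrt hx']
    have := hx.ne'
    have h5 : Real.log (1 - x) ≠ 0 := neg_ne_zero.1 this
    field_simp
    ring
  simp only [Pi.div_apply]
  rw [e2, logQuot, artanhQuot]
  rcases eq_or_ne (Real.artanh √x) 0 with h0 | h0
  · simp [h0]
  · have h5 : Real.log (1 - x) ≠ 0 := neg_ne_zero.1 hx.ne'
    field_simp

lemma normalizedAnti_hyp_div_artanhQuot (ha : 0 < a) (hb : 0 < b) (hab : a + b ≤ 1) :
    NormalizedAnti (fun x => hyp a b x / artanhQuot x) (2 / B a b) := by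
  have he : EqOn (fun x => hyp a b x / artanhQuot x)
      (fun x => hyp a b x / ser (fun n : ℕ => 1 / (2 * (n : ℝ) + 1)) x) (Ioo 0 1) :=
    fun x hx => by simp only [artanhQuot_eq_ser hx]
  have hlim : Tendsto (fun x => hyp a b x / artanhQuot x) (𝓝[<] 1) (𝓝 (2 / B a b)) := by
    have h := (tendsto_hyp_div_logQuot ha hb hab).mul tendsto_logQuot_div_artanhQuot
    rw [inv_mul_eq_div] at h
    refine h.congr' ?_
    filter_upwards [tendsto_logQuot.eventually_gt_atTop 0] with x hx
    exact div_mul_div_cancel₀ hx.ne'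
  refine (normalizedAnti_hyp_div_ser ha hb hab (fun n => ?_) (fun n => by positivity) (by simp)
    (fun n => ?_) (hlim.congr' (he.eventuallyEq_of_mem (Ioo_mem_nhdsLT zero_lt_one)))).congr he
  · rw [abs_of_pos (by positivity), div_le_one (by positivity)]
    linarith [n.cast_nonneg (α := ℝ)]
  · have hc := coef_pos ha hb n
    have hn := n.cast_nonneg (α := ℝ)
    rw [coef_succ, mul_assoc]
    refine mul_lt_mul_of_pos_left ?_ hc
    push_cast
    rw [mul_one_div, div_div, div_lt_div_iff₀ (by positivity) (by positivity)]
    -- Here the cleared inequality is (1 - 2ab)n + (a+b) - 3ab > 0.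
    have h1 : a * b ≤ (a + b) / 4 := by nlinarith [sq_nonneg (a - b)]
    have h2 : a * b * n ≤ 1 / 4 * n := by
      gcongr
      linarith
    nlinarith

lemma normalizedAnti_sqrt_mul_hyp (ha : 0 < a) (hb : 0 < b) (hab : a + b ≤ 1) :
    NormalizedAnti (fun x => √(1 - x) * hyp a b x) 0 where
  continuousOn := (continuousOn_const.sub continuousOn_id).sqrt.mul
    ((continuousOn_hyp ha hb hab).mono Ioo_subset_Ico_self)
  strictAntiOn x hx y hy hxy := by
    have h := one_sub_mul_hyp_sq_strictAntiOn ha hb hab ⟨hx.1.le, hx.2⟩ ⟨hy.1.le, hy.2⟩ hxy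
    have hF := hyp_pos ha hb hab hx.1.le hx.2
    refine lt_of_pow_lt_pow_left₀ 2 (by positivity) ?_
    simp only [mul_pow]
    rwa [Real.sq_sqrt (one_sub_mem_Ioo hx).1.le, Real.sq_sqrt (one_sub_mem_Ioo hy).1.le]
  pos x hx := mul_pos (Real.sqrt_pos.2 (one_sub_mem_Ioo hx).1) (hyp_pos ha hb hab hx.1.le hx.2)
  tendsto_zero := by
    have h : Tendsto (fun x : ℝ => √(1 - x)) (𝓝[>] 0) (𝓝 (√(1 - 0))) :=
      ((continuous_const.sub continuous_id).sqrt.tendsto 0).mono_left nhdsWithin_le_nhds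
    simpa using h.mul (tendsto_hyp_nhdsGT_zero ha hb hab)
  tendsto_one := tendsto_sqrt_mul_hyp ha hb hab

lemma normalizedAnti_one_sub_mul_hyp (ha : 0 < a) (hb : 0 < b) (hab : a + b ≤ 1) :
    NormalizedAnti (fun x => √(1 - x) * (√(1 - x) * hyp a b x)) 0 := by
  have hE := normalizedAnti_sqrt_mul_hyp ha hb hab
  have hc : Continuous fun x : ℝ => √(1 - x) := (continuous_const.sub continuous_id).sqrt
  have h0 := (hc.tendsto 0).mono_left (nhdsWithin_le_nhds (s := Ioi 0))
  have h1 := (hc.tendsto 1).mono_left (nhdsWithin_le_nhds (s := Iio 1))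
  refine ⟨hc.continuousOn.mul hE.continuousOn, fun x hx y hy hxy => ?_,
    fun x hx => mul_pos (Real.sqrt_pos.2 (one_sub_mem_Ioo hx).1) (hE.pos x hx), ?_, ?_⟩
  · exact mul_lt_mul (Real.sqrt_lt_sqrt (one_sub_mem_Ioo hy).1.le (by linarith))
      (hE.strictAntiOn hx hy hxy).le (hE.pos y hy) (Real.sqrt_nonneg _)
  · simpa using h0.mul hE.tendsto_zero
  · simpa using h1.mul hE.tendsto_one

end

/-! ### The generalized modulus in terms of `r ^ 2` -/

section
variable {a b r : ℝ}

lemma compl_eq_sqrt (r : ℝ) : compl r = √(1 - r ^ 2) := rfl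

lemma mu_eq (hr : r ∈ Ioo (0 : ℝ) 1) :
    mu a (a + b) r = B a b / 2 * (hyp a b (1 - r ^ 2) / hyp a b (r ^ 2)) := by
  rw [mu, mu₃, add_sub_cancel_left, hyp_eq_ser, compl_eq_sqrt,
    Real.sq_sqrt (one_sub_mem_Ioo (sq_mem_Ioo hr)).1.le]
  rfl

lemma log_eq_half_log_sq (r : ℝ) : Real.log r = Real.log (r ^ 2) / 2 := by
  rw [Real.log_pow]
  push_cast
  ring

lemma log_compl (hr : r ∈ Ioo (0 : ℝ) 1) : Real.log (compl r) = Real.log (1 - r ^ 2) / 2 :=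
  Real.log_sqrt (one_sub_mem_Ioo (sq_mem_Ioo hr)).1.le

lemma log_ne_zero_of_mem (hr : r ∈ Ioo (0 : ℝ) 1) : Real.log r ≠ 0 :=
  (Real.log_neg hr.1 hr.2).ne

lemma f₂_eq (ha : 0 < a) (hb : 0 < b) (hab : a + b ≤ 1) (hr : r ∈ Ioo (0 : ℝ) 1) :
    f₂ a (a + b) r = B a b / 2 * (hyp a b (1 - r ^ 2) / logQuot (1 - r ^ 2) /
      (hyp a b (r ^ 2) / logQuot (r ^ 2))) := by
  have hx := sq_mem_Ioo hr
  have hx' := one_sub_mem_Ioo hx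
  have h1 := log_ne_zero_of_mem hx
  have h2 := log_ne_zero_of_mem hx'
  have h3 := (hyp_pos ha hb hab hx.1.le hx.2).ne'
  rw [f₂, mu_eq hr, log_compl hr, log_eq_half_log_sq r, compl_eq_sqrt, Real.sq_sqrt hx'.1.le,
    logQuot, logQuot, sub_sub_cancel]
  generalize r ^ 2 = x at *
  have h0 := hx.1.ne'
  have h0' := hx'.1.ne'
  field_simp

lemma f₃_eq (ha : 0 < a) (hb : 0 < b) (hab : a + b ≤ 1) (hr : r ∈ Ioo (0 : ℝ) 1) :
    f₃ a (a + b) r = B a b / 2 * (hyp a b (1 - r ^ 2) / artanhQuot (1 - r ^ 2) /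
      (hyp a b (r ^ 2) / artanhQuot (r ^ 2))) := by
  have hx := sq_mem_Ioo hr
  have hx' := one_sub_mem_Ioo hx
  have h1 := (hyp_pos ha hb hab hx.1.le hx.2).ne'
  have h2 := (sqrt_mem_Ioo hx').1.ne'
  have h3 := (Real.artanh_pos (sqrt_mem_Ioo hx')).ne'
  have h4 := hr.1.ne'
  rw [f₃, mu_eq hr, compl_eq_sqrt, artanhQuot, artanhQuot, Real.sqrt_sq hr.1.le]
  field_simp

lemma f₄_eq (ha : 0 < a) (hb : 0 < b) (hab : a + b ≤ 1) (hr : r ∈ Ioo (0 : ℝ) 1) :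
    f₄ a (a + b) r = B a b * (hyp a b (1 - r ^ 2) / logQuot (1 - r ^ 2) /
      (√(1 - r ^ 2) * hyp a b (r ^ 2))) := by
  have hx := sq_mem_Ioo hr
  have hx' := one_sub_mem_Ioo hx
  have h1 := (hyp_pos ha hb hab hx.1.le hx.2).ne'
  have h2 := (sqrt_mem_Ioo hx').1.ne'
  have h3 := log_ne_zero_of_mem hx
  have h4 := Real.sq_sqrt hx'.1.le
  rw [f₄, mu_eq hr, one_div, Real.log_inv, log_eq_half_log_sq r, compl_eq_sqrt, logQuot,
    sub_sub_cancel]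
  generalize r ^ 2 = x at *
  field_simp
  rw [h4]

lemma f₄'_eq (ha : 0 < a) (hb : 0 < b) (hab : a + b ≤ 1) (hr : r ∈ Ioo (0 : ℝ) 1) :
    f₄' a (a + b) r = B a b * (hyp a b (1 - r ^ 2) / logQuot (1 - r ^ 2) /
      (√(1 - r ^ 2) * (√(1 - r ^ 2) * hyp a b (r ^ 2)))) := by
  have hx := sq_mem_Ioo hr
  have hx' := one_sub_mem_Ioo hx
  have h1 := (hyp_pos ha hb hab hx.1.le hx.2).ne'
  have h3 := log_ne_zero_of_mem hx
  have h5 := hx'.1.ne'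
  rw [f₄', mu_eq hr, one_div, Real.log_inv, log_eq_half_log_sq r, logQuot,
    sub_sub_cancel, ← mul_assoc (√(1 - r ^ 2)), Real.mul_self_sqrt hx'.1.le]
  generalize r ^ 2 = x at *
  field_simp

lemma f₅_eq (ha : 0 < a) (hb : 0 < b) (hab : a + b ≤ 1) (hr : r ∈ Ioo (0 : ℝ) 1) :
    f₅ a (a + b) r = B a b / 2 * (√(1 - (1 - r ^ 2)) * hyp a b (1 - r ^ 2) /
      (hyp a b (r ^ 2) / artanhQuot (r ^ 2))) := by
  have hx := sq_mem_Ioo hr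
  have h1 := (hyp_pos ha hb hab hx.1.le hx.2).ne'
  have h4 := hr.1.ne'
  rw [f₅, mu_eq hr, sub_sub_cancel, artanhQuot, Real.sqrt_sq hr.1.le]
  field_simp

lemma f₆_eq (hr : r ∈ Ioo (0 : ℝ) 1) :
    f₆ a (a + b) r = B a b / 4 * (hypRatio a b (r ^ 2) *
      (Real.log (r ^ 2) - Real.log (1 - r ^ 2))) := by
  have hx' := one_sub_mem_Ioo (sq_mem_Ioo hr)
  rw [f₆, mu_eq hr, compl_eq_sqrt, Real.log_div hr.1.ne' (sqrt_mem_Ioo hx').1.ne', ← compl_eq_sqrt, log_compl hr,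
    log_eq_half_log_sq r, hypRatio]
  ring

/-! ### The first function -/

lemma f₁_eq (hr : r ∈ Ioo (0 : ℝ) 1) :
    f₁ a (a + b) r = B a b / 2 * hypRatio a b (r ^ 2) + Real.log (r ^ 2) / 2 := by
  rw [f₁, mu_eq hr, log_eq_half_log_sq r, hypRatio]

lemma hasDerivAt_hypRatio_add_log (ha : 0 < a) (hb : 0 < b) (hab : a + b ≤ 1) {x : ℝ}
    (hx : x ∈ Ioo (0 : ℝ) 1) :
    HasDerivAt (fun x => B a b / 2 * hypRatio a b x + Real.log x / 2)
      (B a b / 2 * -(legendre a b x / (x * (1 - x) * hyp a b x ^ 2)) + x⁻¹ / 2) x :=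
  ((hasDerivAt_hypRatio ha hb hab hx).const_mul _).add
    ((Real.hasDerivAt_log hx.1.ne').div_const 2)

lemma strictAntiOn_hypRatio_add_log (ha : 0 < a) (hb : 0 < b) (hab : a + b ≤ 1) :
    StrictAntiOn (fun x => B a b / 2 * hypRatio a b x + Real.log x / 2) (Ioo 0 1) := by
  refine strictAntiOn_of_deriv_neg (convex_Ioo 0 1) (fun x hx =>
    (hasDerivAt_hypRatio_add_log ha hb hab hx).continuousAt.continuousWithinAt) fun x hx => ?_
  rw [interior_Ioo] at hx
  rw [(hasDerivAt_hypRatio_add_log ha hb hab hx).deriv]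
  have h1 : (1 - x) * hyp a b x ^ 2 < 1 := by
    have := one_sub_mul_hyp_sq_strictAntiOn ha hb hab ⟨le_rfl, one_pos⟩ ⟨hx.1.le, hx.2⟩ hx.1
    simpa [hyp, ser_zero, coef_zero] using this
  have h2 : 1 ≤ B a b * legendre a b x := by
    have := mul_le_mul_of_nonneg_left (inv_B_le_legendre ha hb hab hx) (B_pos ha hb).le
    rwa [mul_inv_cancel₀ (B_pos ha hb).ne'] at this
  have h3 : 0 < (1 - x) * hyp a b x ^ 2 :=
    mul_pos (one_sub_mem_Ioo hx).1 (pow_pos (hyp_pos ha hb hab hx.1.le hx.2) 2)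
  -- The sign is decided by BΛ ≥ 1 > (1-x)F².
  have e : B a b / 2 * -(legendre a b x / (x * (1 - x) * hyp a b x ^ 2)) + x⁻¹ / 2 =
      -((B a b * legendre a b x - (1 - x) * hyp a b x ^ 2) /
        (2 * x * ((1 - x) * hyp a b x ^ 2))) := by
    have := hx.1.ne'
    have := (one_sub_mem_Ioo hx).1.ne'
    have := (hyp_pos ha hb hab hx.1.le hx.2).ne'
    field_simp
    ring
  rw [e, neg_lt_zero]
  exact div_pos (by linarith) (by have := hx.1; positivity)

lemma tendsto_hypRatio (ha : 0 < a) (hb : 0 < b) (hab : a + b ≤ 1) :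
    Tendsto (hypRatio a b) (𝓝[<] 1) (𝓝 0) :=
  ((tendsto_hyp_nhdsGT_zero ha hb hab).comp tendsto_one_sub_nhdsLT).div_atTop
    (tendsto_hyp_nhdsLT_one ha hb hab)

lemma tendsto_hypRatio_add_log_one (ha : 0 < a) (hb : 0 < b) (hab : a + b ≤ 1) :
    Tendsto (fun x => B a b / 2 * hypRatio a b x + Real.log x / 2) (𝓝[<] 1) (𝓝 0) := by
  have h : Tendsto Real.log (𝓝[<] 1) (𝓝 (Real.log 1)) :=
    (Real.continuousAt_log one_ne_zero).tendsto.mono_left nhdsWithin_le_nhds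
  simpa using ((tendsto_hypRatio ha hb hab).const_mul (B a b / 2)).add (h.div_const 2)

lemma tendsto_mul_log : Tendsto (fun x => x * Real.log x) (𝓝[>] 0) (𝓝 0) := by
  simpa [mul_comm] using tendsto_log_mul_rpow_nhdsGT_zero one_pos

lemma tendsto_hypRatio_add_log_zero (ha : 0 < a) (hb : 0 < b) (hab : a + b ≤ 1) :
    Tendsto (fun x => B a b / 2 * hypRatio a b x + Real.log x / 2) (𝓝[>] 0) (𝓝 (R a b / 2)) := by
  have hF := tendsto_hyp_nhdsGT_zero ha hb hab
  have hid : Tendsto (fun x : ℝ => x) (𝓝[>] 0) (𝓝 0) := tendsto_id.mono_left nhdsWithin_le_nhds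
  have hR := (tendsto_B_mul_ser_coef_sub_logQuot ha hb hab).comp tendsto_one_sub_nhdsGT
  have hslope := (hasDerivAt_ser (abs_coef_le_one ha hb hab)
    (by simp : |(0 : ℝ)| < 1)).tendsto_slope_zero_right
  simp only [zero_add, ser_zero, coef_zero, smul_eq_mul] at hslope
  -- Twice the function is split as (B F(1-x) - `logQuot (1-x)`)/F(x), which tends to R, plus -x log
  -- x · (F(x) - (F(x)-1)/x)/((1-x)F(x)). The second term vanishes because the difference quotient
  -- of F at 0 stays bounded.
  have h1 := hR.div hF one_ne_zero
  have h2 := (tendsto_mul_log.neg.mul (hF.sub hslope)).div ((hid.const_sub 1).mul hF) (by norm_num)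
  have h := (h1.add h2).div_const 2
  simp only [neg_zero, zero_mul, zero_div, add_zero, div_one] at h
  refine h.congr' ?_
  filter_upwards [Ioo_mem_nhdsGT zero_lt_one] with x hx
  have h0 := hx.1.ne'
  have h3 := (one_sub_mem_Ioo hx).1.ne'
  have h4 := (hyp_pos ha hb hab hx.1.le hx.2).ne'
  simp only [Pi.div_apply, Function.comp_apply, logQuot, hypRatio, sub_sub_cancel]
  simp only [hyp] at h4 ⊢
  field_simp
  ring

lemma tendsto_f₁_one (ha : 0 < a) (hb : 0 < b) (hab : a + b ≤ 1) :
    Tendsto (f₁ a (a + b)) (𝓝[<] 1) (𝓝 0) := by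
  refine ((tendsto_hypRatio_add_log_one ha hb hab).comp tendsto_sq_nhdsLT_one).congr' ?_
  filter_upwards [Ioo_mem_nhdsLT zero_lt_one] with r hr
  exact (f₁_eq hr).symm

lemma tendsto_f₁_zero (ha : 0 < a) (hb : 0 < b) (hab : a + b ≤ 1) :
    Tendsto (f₁ a (a + b)) (𝓝[>] 0) (𝓝 (R a b / 2)) := by
  refine ((tendsto_hypRatio_add_log_zero ha hb hab).comp tendsto_sq_nhdsGT_zero).congr' ?_
  filter_upwards [Ioo_mem_nhdsGT zero_lt_one] with r hr
  exact (f₁_eq hr).symm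

lemma strictAntiOn_f₁ (ha : 0 < a) (hb : 0 < b) (hab : a + b ≤ 1) :
    StrictAntiOn (f₁ a (a + b)) (Ioo 0 1) := fun r hr s hs hrs => by
  rw [f₁_eq hr, f₁_eq hs]
  exact strictAntiOn_hypRatio_add_log ha hb hab (sq_mem_Ioo hr) (sq_mem_Ioo hs)
    (pow_lt_pow_left₀ hrs hr.1.le two_ne_zero)

lemma continuousOn_f₁ (ha : 0 < a) (hb : 0 < b) (hab : a + b ≤ 1) :
    ContinuousOn (f₁ a (a + b)) (Ioo 0 1) := by
  have h : ContinuousOn (fun x => B a b / 2 * hypRatio a b x + Real.log x / 2) (Ioo 0 1) :=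
    fun x hx => (hasDerivAt_hypRatio_add_log ha hb hab hx).continuousAt.continuousWithinAt
  exact (h.comp (continuousOn_pow 2) fun r hr => sq_mem_Ioo hr).congr fun r hr => f₁_eq hr

/-- The results on increasing functions are applied to -`f₁`; the endpoint value 0 is its own
negative. -/
lemma neg_update_zero (f : ℝ → ℝ) (q : ℝ) :
    Function.update (fun x => -f x) q 0 = fun x => -Function.update f q 0 x := by
  funext x
  by_cases h : x = q
  · subst h
    simp
  · simp [Function.update_of_ne h]

lemma strictAntiOn_update_f₁ (ha : 0 < a) (hb : 0 < b) (hab : a + b ≤ 1) :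
    StrictAntiOn (Function.update (f₁ a (a + b)) 1 0) (Ioc 0 1) := by
  have hl := (tendsto_f₁_one ha hb hab).neg
  rw [neg_zero] at hl
  have h := strictMonoOn_update (strictAntiOn_f₁ ha hb hab).neg hl
  rw [neg_update_zero] at h
  exact fun x hx y hy hxy => neg_lt_neg_iff.1 (h hx hy hxy)

lemma image_update_f₁ (ha : 0 < a) (hb : 0 < b) (hab : a + b ≤ 1) :
    Function.update (f₁ a (a + b)) 1 0 '' Ioc 0 1 = Ico 0 (R a b / 2) := by
  have hl := (tendsto_f₁_one ha hb hab).neg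
  rw [neg_zero] at hl
  have h := image_update_Ioc_eq_Ioc (f := fun x => -f₁ a (a + b) x) one_pos
    (continuousOn_f₁ ha hb hab).neg
    (strictAntiOn_f₁ ha hb hab).neg (tendsto_f₁_zero ha hb hab).neg hl
  rw [neg_update_zero] at h
  have h2 := congrArg (fun s => Neg.neg '' s) h
  simpa [image_image] using h2

/-! ### The last function -/

/-- This is the nonpositive derivative of the decreasing function F/`logQuot`, with denominators
cleared. -/
lemma mul_log_le (ha : 0 < a) (hb : 0 < b) (hab : a + b ≤ 1) {x : ℝ} (hx : x ∈ Ioo (0 : ℝ) 1) :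
    a * b / (a + b) * hypSucc a b x * -Real.log (1 - x) * x ≤
      hyp a b x * (x - (1 - x) * -Real.log (1 - x)) := by
  have h0 := hx.1
  have h1 := (one_sub_mem_Ioo hx).1
  have hL : 0 < -Real.log (1 - x) := by
    have := Real.log_neg h1 (one_sub_mem_Ioo hx).2
    linarith
  have hq : 0 < logQuot x := div_pos hL h0
  have hlog : HasDerivAt (fun x => -Real.log (1 - x)) (1 / (1 - x)) x :=
    (((hasDerivAt_id x).const_sub 1).log h1.ne').neg.congr_deriv (by simp [neg_div])
  have hd := (hasDerivAt_hyp ha hb hab hx).div (hlog.div (hasDerivAt_id x) h0.ne') hq.ne'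
  have hnonpos := hd.hasDerivWithinAt.nonpos_of_antitoneOn (s := Ioo 0 1)
    (by
      -- Side condition: x is an accumulation point of (0,1).
      have : 𝓝[≠] x ≤ 𝓟 (Ioo (0 : ℝ) 1) :=
        nhdsWithin_le_nhds.trans (le_principal_iff.2 (Ioo_mem_nhds hx.1 hx.2))
      rw [AccPt, inf_eq_left.2 this]
      infer_instance)
    (normalizedAnti_hyp_div_logQuot ha hb hab).strictAntiOn.antitoneOn
  simp only [id, Pi.div_apply] at hnonpos
  rw [div_nonpos_iff] at hnonpos
  rcases hnonpos with h | h
  · exact absurd h.2 (not_le.2 (pow_pos hq 2))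
  · have h2 := h.1
    have hpos : 0 < x ^ 2 * (1 - x) := by positivity
    set L := -Real.log (1 - x)
    have e : a * b / (a + b) * hypSucc a b x / (1 - x) * (L / x) -
        hyp a b x * ((1 / (1 - x) * x - L * 1) / x ^ 2) =
        (a * b / (a + b) * hypSucc a b x * L * x - hyp a b x * (x - (1 - x) * L)) /
          (x ^ 2 * (1 - x)) := by
      field_simp
    rw [e, div_le_iff₀ hpos, zero_mul] at h2
    linarith

lemma legendre_mul_log_lt (ha : 0 < a) (hb : 0 < b) (hab : a + b ≤ 1) {x : ℝ}
    (hx : x ∈ Ioo (1 / 2 : ℝ) 1) :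
    legendre a b x * (Real.log x - Real.log (1 - x)) < hyp a b x * hyp a b (1 - x) := by
  have hx01 : x ∈ Ioo (0 : ℝ) 1 := ⟨by linarith [hx.1], hx.2⟩
  have hx' := one_sub_mem_Ioo hx01
  have hF := hyp_pos ha hb hab hx01.1.le hx.2
  have hF' := hyp_pos ha hb hab hx'.1.le hx'.2
  have hG := hypSucc_pos ha hb hab hx01.1.le hx.2
  have hG' := hypSucc_pos ha hb hab hx'.1.le hx'.2
  have hGF' := hypSucc_le_hyp ha hb hab hx'.1.le hx'.2
  have hk := four_mul_le ha hb hab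
  have hk0 : 0 < a * b / (a + b) := by positivity
  have key := mul_log_le ha hb hab hx01
  have hl0 : Real.log x - Real.log (1 - x) > 0 := by
    have := Real.log_lt_log hx'.1 (by linarith [hx.1] : 1 - x < x)
    linarith
  have hl1 : Real.log x - Real.log (1 - x) ≤ -Real.log (1 - x) := by
    have := Real.log_nonpos hx01.1.le hx.2.le
    linarith
  rw [legendre]
  set L := -Real.log (1 - x)
  set l := Real.log x - Real.log (1 - x)
  have hL : 0 < L := hl0.trans_le hl1
  set k := a * b / (a + b)
  -- The first half of Λ is bounded crudely by k ≤ 1/4 and G ≤ F at 1 - x; the second half needs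
  -- `mul_log_le`. Together they give at most F(x)F(1-x)(x - ¾(1-x)L), and `t4` is what is missing
  -- to F(x)F(1-x).
  have t1 : k * ((1 - x) * hypSucc a b (1 - x) * hyp a b x) * l ≤
      1 / 4 * ((1 - x) * hyp a b (1 - x) * hyp a b x) * L := by
    have := hx'.1
    gcongr
    linarith
  have t2 : k * (x * hypSucc a b x * hyp a b (1 - x)) * l ≤
      k * (x * hypSucc a b x * hyp a b (1 - x)) * L := by
    have := hx01.1
    gcongr
  have t3 := mul_le_mul_of_nonneg_right key hF'.le
  have t4 : 0 < hyp a b x * hyp a b (1 - x) * ((1 - x) + 3 / 4 * (1 - x) * L) := by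
    have := hx'.1
    positivity
  linarith

lemma hasDerivAt_hypRatio_mul_log (ha : 0 < a) (hb : 0 < b) (hab : a + b ≤ 1) {x : ℝ}
    (hx : x ∈ Ioo (0 : ℝ) 1) :
    HasDerivAt (fun x => hypRatio a b x * (Real.log x - Real.log (1 - x)))
      ((hyp a b x * hyp a b (1 - x) - legendre a b x * (Real.log x - Real.log (1 - x))) /
        (x * (1 - x) * hyp a b x ^ 2)) x := by
  have h0 := hx.1.ne'
  have h1 := (one_sub_mem_Ioo hx).1.ne'
  have h2 := (hyp_pos ha hb hab hx.1.le hx.2).ne'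
  refine ((hasDerivAt_hypRatio ha hb hab hx).mul ((Real.hasDerivAt_log h0).sub
    (((hasDerivAt_id x).const_sub 1).log h1))).congr_deriv ?_
  simp only [id, Pi.sub_apply, hypRatio]
  field_simp
  ring

lemma strictMonoOn_hypRatio_mul_log (ha : 0 < a) (hb : 0 < b) (hab : a + b ≤ 1) :
    StrictMonoOn (fun x => hypRatio a b x * (Real.log x - Real.log (1 - x))) (Ico (1 / 2) 1) := by
  have hsub : ∀ {x : ℝ}, x ∈ Ico (1 / 2 : ℝ) 1 → x ∈ Ioo (0 : ℝ) 1 := fun hx =>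
    ⟨by linarith [hx.1], hx.2⟩
  refine strictMonoOn_of_deriv_pos (convex_Ico _ _) (fun x hx =>
    (hasDerivAt_hypRatio_mul_log ha hb hab (hsub hx)).continuousAt.continuousWithinAt) fun x hx => ?_
  rw [(hasDerivAt_hypRatio_mul_log ha hb hab (hsub (interior_subset hx))).deriv]
  rw [interior_Ico] at hx
  have hx01 := hsub ⟨hx.1.le, hx.2⟩
  have h1 := legendre_mul_log_lt ha hb hab hx
  exact div_pos (by linarith) (mul_pos (mul_pos hx01.1 (one_sub_mem_Ioo hx01).1)
    (pow_pos (hyp_pos ha hb hab hx01.1.le hx01.2) 2))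

lemma tendsto_hypRatio_mul_log (ha : 0 < a) (hb : 0 < b) (hab : a + b ≤ 1) :
    Tendsto (fun x => hypRatio a b x * (Real.log x - Real.log (1 - x))) (𝓝[<] 1)
      (𝓝 (B a b)) := by
  have hid : Tendsto (fun x : ℝ => x) (𝓝[<] 1) (𝓝 1) := tendsto_id.mono_left nhdsWithin_le_nhds
  have hlog : Tendsto Real.log (𝓝[<] 1) (𝓝 (Real.log 1)) :=
    (Real.continuousAt_log one_ne_zero).tendsto.mono_left nhdsWithin_le_nhds
  -- The part with log x tends to 0 · 0. The part with -log(1-x) equals F(1-x) · x · (F(x)/`logQuot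
  -- x`)⁻¹ and tends to B.
  have h1 := (tendsto_hypRatio ha hb hab).mul hlog
  have h2 := ((tendsto_hyp_nhdsGT_zero ha hb hab).comp tendsto_one_sub_nhdsLT).mul
    (hid.mul ((tendsto_hyp_div_logQuot ha hb hab).inv₀ (inv_pos.2 (B_pos ha hb)).ne'))
  have h := h1.add h2
  simp only [zero_mul, zero_add, one_mul, inv_inv] at h
  refine h.congr' ?_
  filter_upwards [Ioo_mem_nhdsLT zero_lt_one] with x hx
  have h0 := hx.1.ne'
  simp only [Function.comp_apply, hypRatio, logQuot, inv_div]
  field_simp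
  ring

lemma sq_mem_Ico_of_mem (hr : r ∈ Ico (1 / √2) 1) :
    r ∈ Ioo (0 : ℝ) 1 ∧ r ^ 2 ∈ Ico (1 / 2 : ℝ) 1 := by
  have h0 : 0 < 1 / √2 := by positivity
  have hr' : r ∈ Ioo (0 : ℝ) 1 := ⟨h0.trans_le hr.1, hr.2⟩
  refine ⟨hr', ?_, (sq_mem_Ioo hr').2⟩
  have := pow_le_pow_left₀ h0.le hr.1 2
  rwa [div_pow, one_pow, Real.sq_sqrt zero_le_two] at this

lemma strictMonoOn_f₆ (ha : 0 < a) (hb : 0 < b) (hab : a + b ≤ 1) :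
    StrictMonoOn (f₆ a (a + b)) (Ico (1 / √2) 1) := fun r hr s hs hrs => by
  obtain ⟨hr1, hr2⟩ := sq_mem_Ico_of_mem hr
  obtain ⟨hs1, hs2⟩ := sq_mem_Ico_of_mem hs
  rw [f₆_eq hr1, f₆_eq hs1]
  have hB := B_pos ha hb
  exact mul_lt_mul_of_pos_left (strictMonoOn_hypRatio_mul_log ha hb hab hr2 hs2
    (pow_lt_pow_left₀ hrs hr1.1.le two_ne_zero)) (by positivity)

lemma image_f₆ (ha : 0 < a) (hb : 0 < b) (hab : a + b ≤ 1) :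
    f₆ a (a + b) '' Ico (1 / √2) 1 = Ico 0 ((B a b / 2) ^ 2) := by
  have h2 : 1 / √2 < 1 := by
    rw [div_lt_one (by positivity), Real.lt_sqrt zero_le_one]
    norm_num
  have hc : ContinuousOn (f₆ a (a + b)) (Ico (1 / √2) 1) := by
    have h : ContinuousOn (fun x => B a b / 4 * (hypRatio a b x *
        (Real.log x - Real.log (1 - x)))) (Ioo 0 1) := fun x hx =>
      ((hasDerivAt_hypRatio_mul_log ha hb hab hx).const_mul _).continuousAt.continuousWithinAt
    exact (h.comp (continuousOn_pow 2) fun r hr => sq_mem_Ioo (sq_mem_Ico_of_mem hr).1).congr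
      fun r hr => f₆_eq (sq_mem_Ico_of_mem hr).1
  have hl : Tendsto (f₆ a (a + b)) (𝓝[<] 1) (𝓝 ((B a b / 2) ^ 2)) := by
    have h := ((tendsto_hypRatio_mul_log ha hb hab).comp tendsto_sq_nhdsLT_one).const_mul
      (B a b / 4)
    rw [show B a b / 4 * B a b = (B a b / 2) ^ 2 by ring] at h
    refine h.congr' ?_
    filter_upwards [Ioo_mem_nhdsLT zero_lt_one] with r hr
    exact (f₆_eq hr).symm
  have h0 : f₆ a (a + b) (1 / √2) = 0 := by
    rw [f₆_eq ⟨by positivity, h2⟩, div_pow, one_pow, Real.sq_sqrt zero_le_two]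
    norm_num
  rw [image_Ico_eq_Ico h2 hc (strictMonoOn_f₆ ha hb hab) hl, h0]

end

end GenModulus

end

/-! ### Assembly of the six assertions -/

open GenModulus in
theorem mainTheorem2 (a c : ℝ) (ha : 0 < a) (hac : a < c) (hc : c ≤ 1) :
    -- (1), with the value at `r = 1` given by the limit from the left
    (Tendsto (GenModulus.f₁ a c) (𝓝[<] 1) (𝓝 0) ∧
      StrictAntiOn (Function.update (GenModulus.f₁ a c) 1 0) (Ioc 0 1) ∧
      Function.update (GenModulus.f₁ a c) 1 0 '' Ioc 0 1
        = Ico 0 (GenModulus.R a (c - a) / 2)) ∧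
    -- (2), with the value at `r = 1` given by the limit from the left
    (Tendsto (GenModulus.f₂ a c) (𝓝[<] 1) (𝓝 (GenModulus.B a (c - a) ^ 2 / 2)) ∧
      StrictMonoOn
        (Function.update (GenModulus.f₂ a c) 1 (GenModulus.B a (c - a) ^ 2 / 2)) (Ioc 0 1) ∧
      Function.update (GenModulus.f₂ a c) 1 (GenModulus.B a (c - a) ^ 2 / 2) '' Ioc 0 1
        = Ioc (1 / 2) (GenModulus.B a (c - a) ^ 2 / 2)) ∧
    -- (3), on `(0, 1)`, and on `(0, 1]` with the value at `r = 1` given by the limit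
    (StrictMonoOn (GenModulus.f₃ a c) (Ioo 0 1) ∧
      GenModulus.f₃ a c '' Ioo 0 1 = Ioo 1 ((GenModulus.B a (c - a) / 2) ^ 2) ∧
      Tendsto (GenModulus.f₃ a c) (𝓝[<] 1) (𝓝 ((GenModulus.B a (c - a) / 2) ^ 2)) ∧
      StrictMonoOn
        (Function.update (GenModulus.f₃ a c) 1 ((GenModulus.B a (c - a) / 2) ^ 2)) (Ioc 0 1) ∧
      Function.update (GenModulus.f₃ a c) 1 ((GenModulus.B a (c - a) / 2) ^ 2) '' Ioc 0 1
        = Ioc 1 ((GenModulus.B a (c - a) / 2) ^ 2)) ∧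
    -- (4)
    (StrictMonoOn (GenModulus.f₄ a c) (Ioo 0 1) ∧
      GenModulus.f₄ a c '' Ioo 0 1 = Ioi 1 ∧
      StrictMonoOn (GenModulus.f₄' a c) (Ioo 0 1) ∧
      GenModulus.f₄' a c '' Ioo 0 1 = Ioi 1) ∧
    -- (5)
    (StrictMonoOn (GenModulus.f₅ a c) (Ioo 0 1) ∧
      GenModulus.f₅ a c '' Ioo 0 1 = Ioo 0 ((GenModulus.B a (c - a) / 2) ^ 2)) ∧
    -- (6)
    (StrictMonoOn (GenModulus.f₆ a c) (Ico (1 / Real.sqrt 2) 1) ∧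
      GenModulus.f₆ a c '' Ico (1 / Real.sqrt 2) 1
        = Ico 0 ((GenModulus.B a (c - a) / 2) ^ 2)) := by
  obtain ⟨b, rfl⟩ : ∃ b, c = a + b := ⟨c - a, by ring⟩
  have hb : 0 < b := by linarith
  rw [add_sub_cancel_left]
  have hB := B_pos ha hb
  have hP := normalizedAnti_hyp_div_logQuot ha hb hc
  have hQ := normalizedAnti_hyp_div_artanhQuot ha hb hc
  have hE := normalizedAnti_sqrt_mul_hyp ha hb hc
  have hD := normalizedAnti_one_sub_mul_hyp ha hb hc
  have hB2 : 0 < B a b / 2 := half_pos hB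
  have f2 := fun r hr => f₂_eq (r := r) ha hb hc hr
  have f3 := fun r hr => f₃_eq (r := r) ha hb hc hr
  have f4 := fun r hr => f₄_eq (r := r) ha hb hc hr
  have f4' := fun r hr => f₄'_eq (r := r) ha hb hc hr
  have f5 := fun r hr => f₅_eq (r := r) ha hb hc hr
  have hi : (B a b)⁻¹ ≠ 0 := (inv_pos.2 hB).ne'
  have hi2 : 2 / B a b ≠ 0 := (div_pos two_pos hB).ne'
  -- The endpoint values: C l at r = 0 and C / l' at r = 1, where l and l' are the limits at 1 of
  -- the numerator and denominator functions.
  have e1 : B a b / 2 * (B a b)⁻¹ = 1 / 2 := by field_simp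
  have e2 : B a b / 2 / (B a b)⁻¹ = B a b ^ 2 / 2 := by field_simp
  have e3 : B a b / 2 * (2 / B a b) = 1 := by field_simp
  have e4 : B a b / 2 / (2 / B a b) = (B a b / 2) ^ 2 := by field_simp
  have e5 : B a b * (B a b)⁻¹ = 1 := mul_inv_cancel₀ hB.ne'
  have m2 := hP.strictMonoOn_div hP hB2 f2
  have m3 := hQ.strictMonoOn_div hQ hB2 f3
  have m4 := hP.strictMonoOn_div hE hB f4
  have m4' := hP.strictMonoOn_div hD hB f4'
  have m5 := hE.strictMonoOn_div hQ hB2 f5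
  have z2 := e1 ▸ hP.tendsto_div_zero hP f2
  have z3 := e3 ▸ hQ.tendsto_div_zero hQ f3
  have z4 := e5 ▸ hP.tendsto_div_zero hE f4
  have z4' := e5 ▸ hP.tendsto_div_zero hD f4'
  have z5 := mul_zero (B a b / 2) ▸ hE.tendsto_div_zero hQ f5
  have o2 := e2 ▸ hP.tendsto_div_one hP hi f2
  have o3 := e4 ▸ hQ.tendsto_div_one hQ hi2 f3
  have o4 := hP.tendsto_div_one_atTop hE hB f4
  have o4' := hP.tendsto_div_one_atTop hD hB f4'
  have o5 := e4 ▸ hE.tendsto_div_one hQ hi2 f5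
  have c2 := hP.continuousOn_div hP f2
  have c3 := hQ.continuousOn_div hQ f3
  have c4 := hP.continuousOn_div hE f4
  have c4' := hP.continuousOn_div hD f4'
  have c5 := hE.continuousOn_div hQ f5
  exact ⟨⟨tendsto_f₁_one ha hb hc, strictAntiOn_update_f₁ ha hb hc, image_update_f₁ ha hb hc⟩,
    ⟨o2, strictMonoOn_update m2 o2, image_update_Ioc_eq_Ioc one_pos c2 m2 z2 o2⟩,
    ⟨m3, image_Ioo_eq_Ioo one_pos c3 m3 z3 o3, o3, strictMonoOn_update m3 o3,
      image_update_Ioc_eq_Ioc one_pos c3 m3 z3 o3⟩,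
    ⟨m4, image_Ioo_eq_Ioi one_pos c4 m4 z4 o4, m4', image_Ioo_eq_Ioi one_pos c4' m4' z4' o4'⟩,
    ⟨m5, image_Ioo_eq_Ioo one_pos c5 m5 z5 o5⟩,
    ⟨strictMonoOn_f₆ ha hb hc, image_f₆ ha hb hc⟩⟩
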